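/- Let $N\ge 2$, let $\Omega\subset\mathbb R^N$ be a bounded domain with boundary of class $C^k$ for some $2\le k\le\infty$ (in particular, any bounded smooth domain), let $\delta(x)=\operatorname{dist}(x,\partial\Omega)$, and for $\rho>0$ let $\Omega_\rho=\{x\in\Omega:\delta(x)<\rho\}$. For $\mu\in\mathbb R$ let $\mathcal L_\mu=-\Delta-\mu/\delta^2$. A positive local super-harmonic of $\mathcal L_\mu$ is a function $\bar h$ such that, for some $\rho>0$, $\bar h\in H^1_{loc}(\Omega_\rho)\cap C(\Omega_\rho)$, $\bar h>0$ in $\Omega_\rho$, and $$\int_{\Omega_\rho}\nabla\bar h\cdot\nabla\varphi\,dx-\int_{\Omega_\rho}\frac{\mu}{\delta^2}\,\bar h\,\varphi\,dx\ \ge\ 0$$ for every $0\le\varphi\in H^1(\Omega_\rho)$ with compact support in $\Omega_\rho$. For $\mu\le 1/4$ put $\beta_\pm=\frac12\pm\sqrt{\frac14-\mu}$. Limits as $x\to\partial\Omega$ are taken over $x\in\Omega$ with $\delta(x)\to 0$. (i) If $\mu<1/4$, then every positive local super-harmonic $\bar h$ of $\mathcal L_\mu$ satisfies $$\liminf_{x\to\partial\Omega}\frac{\bar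 h}{\delta^{\beta_+}}>0,\qquad \liminf_{x\to\partial\Omega}\frac{\bar h}{\delta^{\beta_-}}<\infty.$$ (ii) If $\mu=1/4$, then every positive local super-harmonic $\bar h$ of $\mathcal L_{1/4}$ satisfies $$\liminf_{x\to\partial\Omega}\frac{\bar h}{\delta^{1/2}}>0,\qquad \liminf_{x\to\partial\Omega}\frac{\bar h}{\delta^{1/2}\log\frac1\delta}<\infty.$$ These leading order terms are sharp: in case (i) there exist positive local super-harmonics $\bar h$ and $\bar H$ of $\mathcal L_\mu$ with $\bar h/\delta^{\beta_+}\to1$ and $\bar H/\delta^{\beta_-}\to1$ as $x\to\partial\Omega$, and in case (ii) there exist positive local super-harmonics $\bar h$ and $\bar H$ of $\mathcal L_{1/4}$ with $\bar h/\delta^{1/2}\to1$ and $\bar H/\big(\delta^{1/2}\log\frac1\delta\big)\to1$ as $x\to\partial\Omega$. -/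

import Mathlib

open MeasureTheory Filter Topology Set
open scoped ContDiff

noncomputable section

/-- `Ω` has boundary of class `C^k` (`k ≥ 1`): near each boundary point, `Ω` is the sublevel set
`{f < 0}` of a `C^k` function `f` whose derivative does not vanish at that point. -/
def HasCkBoundary {N : ℕ} (k : ℕ∞) (Ω : Set (EuclideanSpace ℝ (Fin N))) : Prop :=
  ∀ x₀ ∈ frontier Ω, ∃ (U : Set (EuclideanSpace ℝ (Fin N))) (f : EuclideanSpace ℝ (Fin N) → ℝ),
    IsOpen U ∧ x₀ ∈ U ∧ ContDiffOn ℝ k f U ∧ fderiv ℝ f x₀ ≠ 0 ∧ ∀ x ∈ U, (x ∈ Ω ↔ f x < 0)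

/-- The distance `δ(x) = dist(x, ∂Ω)` to the boundary. -/
def bdryDist {N : ℕ} (Ω : Set (EuclideanSpace ℝ (Fin N))) (x : EuclideanSpace ℝ (Fin N)) : ℝ :=
  Metric.infDist x (frontier Ω)

/-- The one-sided neighbourhood `Ω_ρ = {x ∈ Ω : δ(x) < ρ}` of the boundary. -/
def bdryStrip {N : ℕ} (Ω : Set (EuclideanSpace ℝ (Fin N))) (ρ : ℝ) :
    Set (EuclideanSpace ℝ (Fin N)) :=
  {x ∈ Ω | bdryDist Ω x < ρ}

/-- The filter of `x → ∂Ω`, i.e. `x ∈ Ω` and `δ(x) → 0`. -/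
def toBdry {N : ℕ} (Ω : Set (EuclideanSpace ℝ (Fin N))) : Filter (EuclideanSpace ℝ (Fin N)) :=
  comap (bdryDist Ω) (𝓝 0) ⊓ 𝓟 Ω

/-- `g` satisfies the defining identity of a weak (distributional) gradient of `u` in the open
set `U`: `∫_U u ∂_v φ = - ∫_U (g · v) φ` for all `φ ∈ C_c^∞(U)` and all directions `v`. It is used
only together with local square integrability of `u` and `g`. -/
def IsWeakGradient {N : ℕ} (U : Set (EuclideanSpace ℝ (Fin N)))
    (u : EuclideanSpace ℝ (Fin N) → ℝ)
    (g : EuclideanSpace ℝ (Fin N) → EuclideanSpace ℝ (Fin N)) : Prop :=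
  ∀ φ : EuclideanSpace ℝ (Fin N) → ℝ, ContDiff ℝ ∞ φ → HasCompactSupport φ → tsupport φ ⊆ U →
    ∀ v : EuclideanSpace ℝ (Fin N),
      ∫ x in U, u x * fderiv ℝ φ x v = - ∫ x in U, inner ℝ (g x) v * φ x

/-- `u ∈ H¹_loc(U)`, with weak gradient `g`. -/
structure IsH1Loc {N : ℕ} (U : Set (EuclideanSpace ℝ (Fin N)))
    (u : EuclideanSpace ℝ (Fin N) → ℝ)
    (g : EuclideanSpace ℝ (Fin N) → EuclideanSpace ℝ (Fin N)) : Prop where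
  memLp_fun : ∀ K ⊆ U, IsCompact K → MemLp u 2 (volume.restrict K)
  memLp_grad : ∀ K ⊆ U, IsCompact K → MemLp g 2 (volume.restrict K)
  weakGradient : IsWeakGradient U u g

/-- `φ ∈ H¹_c(U)`, with weak gradient `ψ`: `φ` belongs to `H¹(U)` and vanishes almost everywhere
outside some compact subset of `U`. -/
structure IsH1Compact {N : ℕ} (U : Set (EuclideanSpace ℝ (Fin N)))
    (φ : EuclideanSpace ℝ (Fin N) → ℝ)
    (ψ : EuclideanSpace ℝ (Fin N) → EuclideanSpace ℝ (Fin N)) : Prop where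
  memLp_fun : MemLp φ 2 (volume.restrict U)
  memLp_grad : MemLp ψ 2 (volume.restrict U)
  weakGradient : IsWeakGradient U φ ψ
  compactSupport : ∃ K ⊆ U, IsCompact K ∧ ∀ᵐ x ∂volume.restrict U, x ∉ K → φ x = 0

/-- `h` is a super-harmonic of `L_μ = -Δ - μ/δ²` in the open set `G ⊆ Ω`: `h ∈ H¹_loc(G) ∩ C(G)`
and `∫_G ∇h·∇φ - ∫_G (μ/δ²) h φ ≥ 0` for all `0 ≤ φ ∈ H¹_c(G)`. -/
def IsSuperHarmonic {N : ℕ} (Ω : Set (EuclideanSpace ℝ (Fin N))) (μ : ℝ)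
    (G : Set (EuclideanSpace ℝ (Fin N))) (h : EuclideanSpace ℝ (Fin N) → ℝ) : Prop :=
  ContinuousOn h G ∧
    ∃ g : EuclideanSpace ℝ (Fin N) → EuclideanSpace ℝ (Fin N), IsH1Loc G h g ∧
      ∀ (φ : EuclideanSpace ℝ (Fin N) → ℝ)
        (ψ : EuclideanSpace ℝ (Fin N) → EuclideanSpace ℝ (Fin N)),
        IsH1Compact G φ ψ → (∀ᵐ x ∂volume.restrict G, 0 ≤ φ x) →
          0 ≤ (∫ x in G, inner ℝ (g x) (ψ x)) - ∫ x in G, μ / bdryDist Ω x ^ 2 * h x * φ x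

/-- `h` is a positive local super-harmonic of `L_μ`: for some `ρ > 0` it is a super-harmonic in
`Ω_ρ` and positive there. -/
def IsPosLocalSuperHarmonic {N : ℕ} (Ω : Set (EuclideanSpace ℝ (Fin N))) (μ : ℝ)
    (h : EuclideanSpace ℝ (Fin N) → ℝ) : Prop :=
  ∃ ρ : ℝ, 0 < ρ ∧ IsSuperHarmonic Ω μ (bdryStrip Ω ρ) h ∧ ∀ x ∈ bdryStrip Ω ρ, 0 < h x

/-- The larger root `β₊ = 1/2 + √(1/4 - μ)` of `β (1 - β) = μ`, for `μ ≤ 1/4`. -/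
def betaPlus (μ : ℝ) : ℝ := 1 / 2 + Real.sqrt (1 / 4 - μ)

/-- The smaller root `β₋ = 1/2 - √(1/4 - μ)` of `β (1 - β) = μ`, for `μ ≤ 1/4`. -/
def betaMinus (μ : ℝ) : ℝ := 1 / 2 - Real.sqrt (1 / 4 - μ)

/-- `liminf_{x → ∂Ω} h(x) / w(x)`, as an extended real number. -/
def bdryLiminf {N : ℕ} (Ω : Set (EuclideanSpace ℝ (Fin N)))
    (h w : EuclideanSpace ℝ (Fin N) → ℝ) : EReal :=
  liminf (fun x => ((h x / w x : ℝ) : EReal)) (toBdry Ω)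

/-- Both `lo` and `up` are boundary orders for the positive local super-harmonics `h` of `L_μ`:
`liminf h/lo > 0` and `liminf h/up < ∞` for all such `h`. Both are sharp: some such `h` satisfies
`h/lo → 1`, and some such `h` satisfies `h/up → 1`, as `x → ∂Ω`. -/
def HasSharpSuperHarmonicBounds {N : ℕ} (Ω : Set (EuclideanSpace ℝ (Fin N))) (μ : ℝ)
    (lo up : EuclideanSpace ℝ (Fin N) → ℝ) : Prop :=
  (∀ h : EuclideanSpace ℝ (Fin N) → ℝ, IsPosLocalSuperHarmonic Ω μ h →
      0 < bdryLiminf Ω h lo ∧ bdryLiminf Ω h up < ⊤) ∧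
    (∃ h : EuclideanSpace ℝ (Fin N) → ℝ, IsPosLocalSuperHarmonic Ω μ h ∧
      Tendsto (fun x => h x / lo x) (toBdry Ω) (𝓝 1)) ∧
    ∃ h : EuclideanSpace ℝ (Fin N) → ℝ, IsPosLocalSuperHarmonic Ω μ h ∧
      Tendsto (fun x => h x / up x) (toBdry Ω) (𝓝 1)

end

/-! Near a C² boundary the distance δ has a unit gradient and, in an approximate sense, a bounded
Laplacian. Hence Δ(G∘δ) equals G''(δ) up to an error κ|G'(δ)|, and everything reduces to the Euler
operator G'' + μ t⁻² G on (0, b]. Its solutions are t^β₊ and t^β₋, or t^(1/2) and t^(1/2) log(1/t)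
when μ = 1/4. Adding a suitable higher power of t with the right sign yields strict sub- and
super-solutions with the same leading term, whose margin absorbs κ|G'|.

Radial super-solutions composed with δ are super-harmonics (`isSuperHarmonic_comp_bdryDist`), which
gives sharpness. The bounds come from comparing a super-harmonic u > 0 with a radial sub-solution G
on a shell a ≤ δ ≤ b (`IsSuperHarmonic.comparison`). For the lower bound, take G of the lower order
and subtract ε times a super-solution of the upper order, so that the difference is negative close
to ∂Ω; then let ε → 0. For the upper bound, take G of the upper order with G(b) ≤ 0: if u/up had
infinite liminf, then G ≤ C u would follow for every C > 0, hence G ≤ 0, although G > 0 near ∂Ω.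

No sign of μ is needed in the comparison: at the largest value s of G∘δ/u the zeroth-order terms of
G∘δ and s u agree, so they cancel.

Only a C^{1,1} estimate for δ is used, obtained from touching balls
(`exists_bdryDist_quadratic_bound`). Both δ and u are mollified. The mollified distance has a
Hessian bounded independently of the radius, and the mollified u is an almost classical
super-solution, so the comparison becomes a pointwise maximum principle. -/

noncomputable section

/-! ### Touching balls and the C^{1,1} estimate for the distance function. -/

section Geometry

variable {N : ℕ} {Ω : Set (EuclideanSpace ℝ (Fin N))}

local notation "𝔼" => EuclideanSpace ℝ (Fin N)

lemma isCompact_frontier_of_isBounded (hb : Bornology.IsBounded Ω) : IsCompact (frontier Ω) :=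
  Metric.isCompact_of_isClosed_isBounded isClosed_frontier
    (hb.closure.subset frontier_subset_closure)

/-- A local Taylor estimate with uniform quadratic remainder for a `C²` function. -/
lemma exists_ball_taylor_bound {U : Set 𝔼} {f : 𝔼 → ℝ} {x₀ : 𝔼} (hU : IsOpen U) (hx : x₀ ∈ U)
    (hf : ContDiffOn ℝ 2 f U) (hd : fderiv ℝ f x₀ ≠ 0) :
    ∃ η > 0, ∃ L > 0, ∃ m > 0, Metric.ball x₀ η ⊆ U ∧
      (∀ y ∈ Metric.ball x₀ η, m ≤ ‖fderiv ℝ f y‖) ∧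
      ∀ y ∈ Metric.ball x₀ η, ∀ z ∈ Metric.ball x₀ η,
        |f z - f y - fderiv ℝ f y (z - y)| ≤ L * ‖z - y‖ ^ 2 := by
  have hfx : ContDiffAt ℝ 2 f x₀ := hf.contDiffAt (hU.mem_nhds hx)
  have hf1 : ContDiffAt ℝ 1 (fderiv ℝ f) x₀ := hfx.fderiv_right (by norm_num)
  obtain ⟨L, t, ht, hL⟩ := hf1.exists_lipschitzOnWith
  have hm : ∀ᶠ y in 𝓝 x₀, ‖fderiv ℝ f x₀‖ / 2 < ‖fderiv ℝ f y‖ :=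
    hf1.continuousAt.norm.eventually (lt_mem_nhds (half_lt_self (norm_pos_iff.2 hd)))
  obtain ⟨η, hη, hs⟩ := Metric.mem_nhds_iff.1 (inter_mem ht (inter_mem (hU.mem_nhds hx) hm))
  refine ⟨η, hη, L + 1, by positivity, ‖fderiv ℝ f x₀‖ / 2, half_pos (norm_pos_iff.2 hd),
    fun y hy => (hs hy).2.1, fun y hy => (hs hy).2.2.le, fun y hy z hz => ?_⟩
  -- Intersecting with this closed ball gives ‖w - y‖ ≤ ‖z - y‖ on the convex set, so the derivative
  -- varies by at most L‖z - y‖ there.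
  have hconv := (convex_ball x₀ η).inter (convex_closedBall y ‖z - y‖)
  have key := hconv.norm_image_sub_le_of_norm_fderiv_le' (𝕜 := ℝ) (f := f) (x := y) (y := z)
    (φ := fderiv ℝ f y) (C := L * ‖z - y‖)
    (fun w hw => (hf.contDiffAt (hU.mem_nhds (hs hw.1).2.1)).differentiableAt (by norm_num))
    (fun w hw => by
      have := hL.dist_le_mul w (hs hw.1).1 y (hs hy).1
      rw [dist_eq_norm] at this
      exact this.trans (mul_le_mul_of_nonneg_left (Metric.mem_closedBall.1 hw.2) L.2))
    ⟨hy, by simp⟩ ⟨hz, by simp [dist_eq_norm]⟩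
  rw [Real.norm_eq_abs] at key
  nlinarith [sq_nonneg ‖z - y‖]

lemma eq_zero_of_mem_frontier {U : Set 𝔼} {f : 𝔼 → ℝ} (hΩ : IsOpen Ω) (hU : IsOpen U)
    (hf : ContinuousOn f U) (h : ∀ x ∈ U, (x ∈ Ω ↔ f x < 0)) {y : 𝔼} (hy : y ∈ frontier Ω)
    (hyU : y ∈ U) : f y = 0 := by
  have hy2 : y ∉ Ω := fun h' => (hΩ.frontier_eq ▸ hy : y ∈ closure Ω \ Ω).2 h'
  refine le_antisymm ?_ (not_lt.1 fun h' => hy2 ((h y hyU).2 h'))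
  by_contra! hpos
  have h1 : ∀ᶠ z in 𝓝 y, 0 < f z :=
    (hf.continuousAt (hU.mem_nhds hyU)).eventually (lt_mem_nhds hpos)
  have h2 := mem_closure_iff_frequently.1 (frontier_subset_closure hy)
  obtain ⟨z, hz1, hz2, hz3⟩ := (h2.and_eventually (h1.and (hU.mem_nhds hyU))).exists
  exact absurd ((h z hz3).1 hz1) (not_lt.2 hz2.le)

/-- `TwoSidedBall Ω r y`: there are an interior and an exterior ball of radius `r` touching `∂Ω`
at `y` along a common unit normal direction, and likewise for all smaller radii. -/
def TwoSidedBall (Ω : Set 𝔼) (r : ℝ) (y : 𝔼) : Prop :=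
  ∃ n : 𝔼, ‖n‖ = 1 ∧ ∀ s, 0 < s → s ≤ r →
    Metric.ball (y - s • n) s ⊆ Ω ∧ Disjoint (Metric.ball (y + s • n) s) Ω

lemma TwoSidedBall.mono {r r' : ℝ} {y : 𝔼} (h : TwoSidedBall Ω r y) (hr : r' ≤ r) :
    TwoSidedBall Ω r' y := by
  obtain ⟨n, hn, h⟩ := h
  exact ⟨n, hn, fun s hs hsr => h s hs (hsr.trans hr)⟩

/-- In this form a ball touching the origin can be fed to a Taylor expansion: the linear term
controls the quadratic one. -/
lemma inner_lt_of_mem_ball {n w : 𝔼} {s : ℝ} (hn : ‖n‖ = 1) (hs : 0 < s) (h : ‖w - s • n‖ < s) :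
    ‖w‖ ^ 2 < 2 * s * inner ℝ n w := by
  have h1 : ‖w - s • n‖ ^ 2 < s ^ 2 := by gcongr
  rw [norm_sub_sq_real, norm_smul, hn, inner_smul_right, Real.norm_of_nonneg hs.le,
    real_inner_comm] at h1
  linarith

/-- The normal is the normalized gradient of the defining function `f`. On a small touching ball the
linear part of `f` dominates the quadratic remainder, so `f` is negative on the inner ball and
positive on the outer one. -/
lemma exists_nhds_twoSidedBall (hΩ : IsOpen Ω) (hk : HasCkBoundary 2 Ω) {x₀ : 𝔼}
    (hx : x₀ ∈ frontier Ω) :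
    ∃ V ∈ 𝓝 x₀, ∃ r > 0, ∀ y ∈ V ∩ frontier Ω, TwoSidedBall Ω r y := by
  obtain ⟨U, f, hU, hxU, hf, hd, hΩf⟩ := hk x₀ hx
  obtain ⟨η, hη, L, hL, m, hm, hsub, hmf, hT⟩ := exists_ball_taylor_bound hU hxU hf hd
  refine ⟨Metric.ball x₀ (η / 2), Metric.ball_mem_nhds _ (half_pos hη),
    -- The bound η/4 keeps both touching balls inside the Taylor ball; m/(2L) makes the linear term
    -- win over the remainder.
    min (η / 4) (m / (2 * L)), by positivity, ?_⟩
  rintro y ⟨hyb, hyF⟩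
  have hyη : y ∈ Metric.ball x₀ η := Metric.ball_subset_ball (by linarith) hyb
  have hfy : f y = 0 := eq_zero_of_mem_frontier hΩ hU hf.continuousOn hΩf hyF (hsub hyη)
  set p : 𝔼 := (InnerProductSpace.toDual ℝ 𝔼).symm (fderiv ℝ f y) with hp
  have hpn : ‖p‖ = ‖fderiv ℝ f y‖ := by rw [hp, LinearIsometryEquiv.norm_map]
  have hpm : m ≤ ‖p‖ := hpn ▸ hmf y hyη
  have hp0 : 0 < ‖p‖ := hm.trans_le hpm
  have hfp : ∀ v, fderiv ℝ f y v = inner ℝ p v := fun v => by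
    rw [hp, InnerProductSpace.toDual_symm_apply]
  set n : 𝔼 := ‖p‖⁻¹ • p with hn
  have hn1 : ‖n‖ = 1 := by rw [hn, norm_smul, norm_inv, norm_norm, inv_mul_cancel₀ hp0.ne']
  have hpv : ∀ v, inner ℝ p v = ‖p‖ * inner ℝ n v := fun v => by
    rw [hn, real_inner_smul_left, ← mul_assoc, mul_inv_cancel₀ hp0.ne', one_mul]
  have hnear : ∀ {w : 𝔼} {s : ℝ} {c : 𝔼}, ‖c‖ = 1 → 0 < s → s ≤ min (η / 4) (m / (2 * L)) →
      ‖w - s • c‖ < s → y + w ∈ Metric.ball x₀ η := by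
    intro w s c hc hs hsr h
    have h1 : ‖w‖ < 2 * s := by
      have := norm_add_le (w - s • c) (s • c)
      rw [sub_add_cancel, norm_smul, hc, Real.norm_of_nonneg hs.le] at this
      linarith
    have h2 := min_le_left (η / 4) (m / (2 * L))
    rw [Metric.mem_ball, dist_eq_norm] at hyb ⊢
    have := norm_add_le (y - x₀) w
    rw [show y + w - x₀ = (y - x₀) + w by abel]
    linarith
  refine ⟨n, hn1, fun s hs hsr => ?_⟩
  have hsL : 2 * L * s ≤ m := by
    have h2 : s ≤ m / (2 * L) := hsr.trans (min_le_right _ _)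
    rw [le_div_iff₀ (by positivity)] at h2
    linarith
  have main : ∀ w : 𝔼, y + w ∈ Metric.ball x₀ η → ∀ a : ℝ, ‖w‖ ^ 2 < 2 * s * a →
      L * ‖w‖ ^ 2 < ‖p‖ * a := by
    intro w _ a ha
    have h0 : 0 < a := by
      have : 0 < 2 * s * a := lt_of_le_of_lt (sq_nonneg _) ha
      exact pos_of_mul_pos_right this (by positivity)
    calc L * ‖w‖ ^ 2 < L * (2 * s * a) := by gcongr
      _ = (2 * L * s) * a := by ring
      _ ≤ ‖p‖ * a := by gcongr; exact hsL.trans hpm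
  constructor
  · intro z hz
    obtain ⟨w, rfl⟩ : ∃ w, z = y + w := ⟨z - y, by abel⟩
    rw [Metric.mem_ball, dist_eq_norm] at hz
    have hz' : ‖w - s • (-n)‖ < s := by
      rw [show w - s • (-n) = y + w - (y - s • n) by module]; exact hz
    have hb := hnear (by rwa [norm_neg]) hs hsr hz'
    have h1 := inner_lt_of_mem_ball (by rwa [norm_neg]) hs hz'
    have h2 := main w hb _ h1
    have h3 := abs_le.1 (hT y hyη _ hb)
    rw [hfy, hfp, add_sub_cancel_left, hpv] at h3
    rw [inner_neg_left] at h2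
    rw [hΩf _ (hsub hb)]
    linarith [h3.2]
  · rw [Set.disjoint_left]
    intro z hz
    obtain ⟨w, rfl⟩ : ∃ w, z = y + w := ⟨z - y, by abel⟩
    rw [Metric.mem_ball, dist_eq_norm] at hz
    have hz' : ‖w - s • n‖ < s := by
      rw [show w - s • n = y + w - (y + s • n) by abel]; exact hz
    have hb := hnear hn1 hs hsr hz'
    have h1 := inner_lt_of_mem_ball hn1 hs hz'
    have h2 := main w hb _ h1
    have h3 := abs_le.1 (hT y hyη _ hb)
    rw [hfy, hfp, add_sub_cancel_left, hpv] at h3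
    rw [hΩf _ (hsub hb)]
    linarith [h3.1]

lemma exists_uniform_twoSidedBall (hΩ : IsOpen Ω) (hb : Bornology.IsBounded Ω)
    (hk : HasCkBoundary 2 Ω) : ∃ r > 0, ∀ y ∈ frontier Ω, TwoSidedBall Ω r y := by
  refine (isCompact_frontier_of_isBounded hb).induction_on
    (p := fun S => ∃ r > 0, ∀ y ∈ S, TwoSidedBall Ω r y) ⟨1, one_pos, by simp⟩ ?_ ?_ ?_
  · rintro s t hst ⟨r, hr, h⟩
    exact ⟨r, hr, fun y hy => h y (hst hy)⟩
  · rintro s t ⟨r, hr, h⟩ ⟨r', hr', h'⟩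
    refine ⟨min r r', lt_min hr hr', ?_⟩
    rintro y (hy | hy)
    · exact (h y hy).mono (min_le_left _ _)
    · exact (h' y hy).mono (min_le_right _ _)
  · intro x hx
    obtain ⟨V, hV, r, hr, h⟩ := exists_nhds_twoSidedBall hΩ hk hx
    exact ⟨V ∩ frontier Ω, inter_mem (mem_nhdsWithin_of_mem_nhds hV) self_mem_nhdsWithin, r, hr, h⟩

lemma bdryDist_nonneg (x : 𝔼) : 0 ≤ bdryDist Ω x := Metric.infDist_nonneg

lemma bdryDist_pos (hΩ : IsOpen Ω) (hF : (frontier Ω).Nonempty) {x : 𝔼} (hx : x ∈ Ω) :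
    0 < bdryDist Ω x := by
  refine (isClosed_frontier.notMem_iff_infDist_pos hF).1 fun h => ?_
  exact (hΩ.frontier_eq ▸ h : x ∈ closure Ω \ Ω).2 hx

lemma abs_bdryDist_sub_le (x y : 𝔼) : |bdryDist Ω x - bdryDist Ω y| ≤ ‖x - y‖ := by
  have := (Metric.lipschitz_infDist_pt (frontier Ω)).dist_le_mul x y
  simpa [Real.dist_eq, dist_eq_norm, bdryDist] using this

lemma continuous_bdryDist : Continuous (bdryDist Ω) := Metric.continuous_infDist_pt _

/-- A ball around a point of `Ω` that does not meet the boundary is contained in `Ω`. -/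
lemma ball_bdryDist_subset (hΩ : IsOpen Ω) {x : 𝔼} (hx : x ∈ Ω) :
    Metric.ball x (bdryDist Ω x) ⊆ Ω := by
  rcases (bdryDist_nonneg (Ω := Ω) x).eq_or_lt with h | h
  · simp [← h]
  have hdisj : ∀ z ∈ Metric.ball x (bdryDist Ω x), z ∉ frontier Ω := fun z hz hzF => by
    have := Metric.infDist_le_dist_of_mem (x := x) hzF
    rw [Metric.mem_ball, dist_comm] at hz
    exact absurd hz (not_lt.2 this)
  refine (convex_ball x _).isPreconnected.subset_left_of_subset_union hΩ
    isClosed_closure.isOpen_compl (disjoint_compl_right.mono_right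
      (compl_subset_compl.2 subset_closure)) (fun z hz => ?_) ⟨x, Metric.mem_ball_self h, hx⟩
  by_contra hcon
  rw [mem_union, not_or, notMem_compl_iff] at hcon
  exact hdisj z hz (hΩ.frontier_eq ▸ ⟨hcon.2, hcon.1⟩)

/-- Interior balls bound δ from below and exterior balls (`bdryDist_le_sub`) from above; the two
bounds sandwich δ in its Taylor estimate. -/
lemma sub_norm_le_bdryDist (hΩ : IsOpen Ω) (hF : (frontier Ω).Nonempty) {c : 𝔼} {r : ℝ}
    (hc : Metric.ball c r ⊆ Ω) (z : 𝔼) : r - ‖z - c‖ ≤ bdryDist Ω z := by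
  refine (Metric.le_infDist hF).2 fun y hy => ?_
  have hy2 : y ∉ Metric.ball c r := fun h =>
    (hΩ.frontier_eq ▸ hy : y ∈ closure Ω \ Ω).2 (hc h)
  rw [Metric.mem_ball, not_lt] at hy2
  have := dist_triangle y z c
  rw [dist_comm y z, dist_eq_norm z c] at this
  linarith

/-- Two disjoint balls have centres at distance at least the sum of the radii. -/
lemma add_le_norm_sub_of_disjoint {x c : 𝔼} {d r : ℝ} (hd : 0 < d) (hr : 0 < r)
    (h : Disjoint (Metric.ball x d) (Metric.ball c r)) : d + r ≤ ‖x - c‖ := by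
  by_contra! hlt
  rw [Set.disjoint_left] at h
  have hdr : 0 < d + r := by positivity
  refine h (a := x + (d / (d + r)) • (c - x)) ?_ ?_
  · rw [Metric.mem_ball, dist_eq_norm, add_sub_cancel_left, norm_smul, norm_sub_rev,
      Real.norm_of_nonneg (by positivity)]
    calc d / (d + r) * ‖x - c‖ < d / (d + r) * (d + r) := by gcongr
      _ = d := by field_simp
  · have : x + (d / (d + r)) • (c - x) - c = (r / (d + r)) • (x - c) := by
      have h1 : r / (d + r) = 1 - d / (d + r) := by field_simp; ring
      rw [h1]; module
    rw [Metric.mem_ball, dist_eq_norm, this, norm_smul, Real.norm_of_nonneg (by positivity)]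
    calc r / (d + r) * ‖x - c‖ < r / (d + r) * (d + r) := by gcongr
      _ = r := by field_simp

/-- The ball of radius δ(z) about z lies in Ω, hence is disjoint from the exterior ball. -/
lemma bdryDist_le_sub (hΩ : IsOpen Ω) (hF : (frontier Ω).Nonempty) {c : 𝔼} {r : ℝ} (hr : 0 < r)
    (hc : Disjoint (Metric.ball c r) Ω) {z : 𝔼} (hz : z ∈ Ω) : bdryDist Ω z ≤ ‖z - c‖ - r := by
  have := add_le_norm_sub_of_disjoint (bdryDist_pos hΩ hF hz) hr
    (hc.symm.mono_left (ball_bdryDist_subset hΩ hz))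
  linarith

/-- This rearranges (‖A • e + v‖ - A)² ≥ 0. It turns distances to the centres of the touching balls
into quadratic bounds. -/
lemma norm_smul_add_le {e v : 𝔼} {A : ℝ} (he : ‖e‖ = 1) (hA : 0 < A) :
    ‖A • e + v‖ ≤ A + inner ℝ e v + ‖v‖ ^ 2 / (2 * A) := by
  have h1 : ‖A • e + v‖ ^ 2 = A ^ 2 + 2 * A * inner ℝ e v + ‖v‖ ^ 2 := by
    rw [norm_add_sq_real, norm_smul, he, real_inner_smul_left, Real.norm_of_nonneg hA.le]; ring
  have h2 : (‖A • e + v‖ - A) ^ 2 ≥ 0 := sq_nonneg _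
  have h3 : ‖A • e + v‖ * (2 * A) ≤ (A + inner ℝ e v + ‖v‖ ^ 2 / (2 * A)) * (2 * A) := by
    field_simp
    nlinarith
  exact le_of_mul_le_mul_right h3 (by positivity)

/-- Near a `C²` boundary the distance function is uniformly `C^{1,1}`: it has a unit gradient
and a uniform two-sided quadratic Taylor estimate. -/
theorem exists_bdryDist_quadratic_bound (hΩ : IsOpen Ω) (hb : Bornology.IsBounded Ω)
    (hF : (frontier Ω).Nonempty) (hk : HasCkBoundary 2 Ω) :
    ∃ r > 0, ∃ K > 0, ∃ e : 𝔼 → 𝔼, ∀ x ∈ Ω, bdryDist Ω x < r → ‖e x‖ = 1 ∧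
      ∀ v, x + v ∈ Ω → |bdryDist Ω (x + v) - bdryDist Ω x - inner ℝ (e x) v| ≤ K * ‖v‖ ^ 2 := by
  obtain ⟨r, hr, hball⟩ := exists_uniform_twoSidedBall hΩ hb hk
  suffices H : ∀ x : 𝔼, ∃ e : 𝔼, x ∈ Ω → bdryDist Ω x < r / 2 → ‖e‖ = 1 ∧
      ∀ v, x + v ∈ Ω → |bdryDist Ω (x + v) - bdryDist Ω x - inner ℝ e v| ≤ r⁻¹ * ‖v‖ ^ 2 by
    choose e he using H
    exact ⟨r / 2, half_pos hr, r⁻¹, inv_pos.2 hr, e, fun x hx hxr => he x hx hxr⟩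
  intro x
  by_cases hxx : x ∈ Ω ∧ bdryDist Ω x < r / 2
  swap
  · exact ⟨0, fun h1 h2 => absurd ⟨h1, h2⟩ hxx⟩
  obtain ⟨hx, hxr⟩ := hxx
  obtain ⟨y, hy, hxy⟩ := (isCompact_frontier_of_isBounded hb).exists_infDist_eq_dist hF x
  obtain ⟨n, hn, hn2⟩ := hball y hy
  obtain ⟨hint, hext⟩ := hn2 r hr le_rfl
  set d := bdryDist Ω x with hd
  have hdpos : 0 < d := bdryDist_pos hΩ hF hx
  have hxyd : ‖x - y‖ = d := by rw [hd, bdryDist, hxy, dist_eq_norm]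
  have hfar := bdryDist_le_sub hΩ hF hr hext hx
  -- Equality case of the triangle inequality: x is at distance d from y and at least d + r from the
  -- exterior centre y + r • n, so it lies on the inner normal at y.
  have hxyn : x = y - d • n := by
    have h1 : (d + r) ^ 2 ≤ ‖(x - y) - r • n‖ ^ 2 := by
      rw [show (x - y) - r • n = x - (y + r • n) by abel]
      gcongr; linarith
    rw [norm_sub_sq_real, norm_smul, hn, inner_smul_right, Real.norm_of_nonneg hr.le, hxyd] at h1
    have h2 : inner ℝ (x - y) n ≤ -d := by nlinarith
    have h3 : ‖(x - y) + d • n‖ ^ 2 ≤ 0 := by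
      rw [norm_add_sq_real, norm_smul, hn, inner_smul_right, Real.norm_of_nonneg hdpos.le, hxyd]
      nlinarith
    have h4 : (x - y) + d • n = 0 := by
      rw [← norm_eq_zero]; exact pow_eq_zero_iff (two_ne_zero) |>.1 (le_antisymm h3 (sq_nonneg _))
    rw [← sub_eq_zero, ← h4]; abel
  refine ⟨-n, fun _ _ => ⟨by rw [norm_neg, hn], fun v hv => ?_⟩⟩
  have hv2 : 0 ≤ ‖v‖ ^ 2 := sq_nonneg _
  rw [abs_le]
  constructor
  · have h1 := sub_norm_le_bdryDist hΩ hF hint (x + v)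
    have h2 : x + v - (y - r • n) = (r - d) • n + v := by rw [hxyn]; module
    have h3 := norm_smul_add_le (v := v) hn (show 0 < r - d by linarith)
    -- Here d < r/2 is used, in the form 2(r - d) ≥ r.
    have h4 : ‖v‖ ^ 2 / (2 * (r - d)) ≤ r⁻¹ * ‖v‖ ^ 2 := by
      rw [div_eq_inv_mul]; gcongr; linarith
    rw [h2] at h1
    rw [inner_neg_left]
    linarith
  · have h1 := bdryDist_le_sub hΩ hF hr hext hv
    have h2 : x + v - (y + r • n) = (r + d) • (-n) + v := by rw [hxyn]; module
    have h3 := norm_smul_add_le (v := v) (show ‖-n‖ = 1 by rwa [norm_neg])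
      (show 0 < r + d by linarith)
    have h4 : ‖v‖ ^ 2 / (2 * (r + d)) ≤ r⁻¹ * ‖v‖ ^ 2 := by
      rw [div_eq_inv_mul]; gcongr; linarith
    rw [h2] at h1
    linarith

end Geometry

/-! ### The mollified distance: gradient and uniform Hessian bounds. -/

section Mollification

variable {N : ℕ} {Ω : Set (EuclideanSpace ℝ (Fin N))}

local notation "𝔼" => EuclideanSpace ℝ (Fin N)

/-- In the one-sided neighbourhood of width `r`, the distance function has the unit gradient `e`
with a quadratic Taylor estimate of constant `K`. -/
structure BdryDistRegular (Ω : Set 𝔼) (r K : ℝ) (e : 𝔼 → 𝔼) : Prop where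
  pos : 0 < K
  norm_eq : ∀ x ∈ Ω, bdryDist Ω x < r → ‖e x‖ = 1
  bound : ∀ x ∈ Ω, bdryDist Ω x < r → ∀ v, x + v ∈ Ω →
    |bdryDist Ω (x + v) - bdryDist Ω x - inner ℝ (e x) v| ≤ K * ‖v‖ ^ 2

namespace BdryDistRegular

variable {r K : ℝ} {e : EuclideanSpace ℝ (Fin N) → EuclideanSpace ℝ (Fin N)}

/-- A two-sided Taylor estimate makes the gradient Lipschitz: expand at x along v + w and v, and at
x + v along w, with w parallel to the difference of gradients and ‖w‖ = ‖v‖. The remainders give 4 +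
1 + 1 = 6. The condition 2‖v‖ < δ(x) keeps x + v + w in Ω. -/
lemma norm_sub_le (h : BdryDistRegular Ω r K e) (hΩ : IsOpen Ω) {x v : 𝔼} (hx : x ∈ Ω)
    (hxr : bdryDist Ω x < r) (hv : 2 * ‖v‖ < bdryDist Ω x) (hvr : bdryDist Ω (x + v) < r) :
    ‖e x - e (x + v)‖ ≤ 6 * K * ‖v‖ := by
  have hsub : ∀ w : 𝔼, ‖w‖ ≤ 2 * ‖v‖ → x + w ∈ Ω := fun w hw =>
    ball_bdryDist_subset hΩ hx (by
      rw [Metric.mem_ball, dist_eq_norm, add_sub_cancel_left]; linarith)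
  have hxv : x + v ∈ Ω := hsub v (by linarith [norm_nonneg v])
  rcases eq_or_ne v 0 with rfl | hv0
  · simp
  rcases eq_or_ne (e x - e (x + v)) 0 with h0 | h0
  · rw [h0, norm_zero]; have := h.pos; positivity
  have hvp : 0 < ‖v‖ := norm_pos_iff.2 hv0
  set u := e x - e (x + v) with hu
  have hup : 0 < ‖u‖ := norm_pos_iff.2 h0
  set w : 𝔼 := (‖v‖ / ‖u‖) • u with hw
  have hwn : ‖w‖ = ‖v‖ := by
    rw [hw, norm_smul (‖v‖ / ‖u‖) u, Real.norm_of_nonneg (by positivity)]; field_simp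
  have hvw : ‖v + w‖ ≤ 2 * ‖v‖ := (norm_add_le _ _).trans (by rw [hwn]; linarith)
  have h1 := abs_le.1 (h.bound x hx hxr (v + w) (hsub _ hvw))
  have h2 := abs_le.1 (h.bound x hx hxr v hxv)
  have h3 := abs_le.1 (h.bound (x + v) hxv hvr w (by rw [add_assoc]; exact hsub _ hvw))
  have h4 : inner ℝ u w = ‖u‖ * ‖v‖ := by
    rw [hw, inner_smul_right, real_inner_self_eq_norm_sq]; field_simp
  have h5 : inner ℝ (e x) w - inner ℝ (e (x + v)) w = ‖u‖ * ‖v‖ := by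
    rw [← inner_sub_left, ← hu, h4]
  rw [inner_add_right, ← add_assoc] at h1
  have h6 : ‖v + w‖ ^ 2 ≤ (2 * ‖v‖) ^ 2 := by gcongr
  have h7 : K * ‖v + w‖ ^ 2 ≤ K * (2 * ‖v‖) ^ 2 := mul_le_mul_of_nonneg_left h6 h.pos.le
  rw [hwn] at h3
  have h8 : ‖u‖ * ‖v‖ ≤ (6 * K * ‖v‖) * ‖v‖ := by linarith [h1.1, h2.2, h3.2, h1.2, h2.1, h3.1]
  exact le_of_mul_le_mul_right h8 hvp

lemma hasFDerivAt (h : BdryDistRegular Ω r K e) (hΩ : IsOpen Ω) {x : 𝔼} (hx : x ∈ Ω)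
    (hxr : bdryDist Ω x < r) : HasFDerivAt (bdryDist Ω) (innerSL ℝ (e x)) x := by
  rw [hasFDerivAt_iff_isLittleO_nhds_zero]
  refine (Asymptotics.IsBigO.of_bound K ?_ : _ =O[𝓝 0] fun v : 𝔼 => ‖v‖ ^ 2).trans_isLittleO
    (Asymptotics.isLittleO_norm_right.1 ?_)
  · have h0 : ∀ᶠ v : 𝔼 in 𝓝 0, x + v ∈ Ω :=
      (continuous_const.add continuous_id).continuousAt.eventually
        (hΩ.mem_nhds (by simpa using hx))
    filter_upwards [h0] with v hv
    simpa using h.bound x hx hxr v hv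
  · have : (fun v : 𝔼 => ‖v‖ ^ 2) = fun v : 𝔼 => ‖v‖ * ‖v‖ := by ext; ring
    rw [this]
    refine (Asymptotics.isLittleO_iff.2 fun c hc => ?_)
    filter_upwards [Metric.ball_mem_nhds (0 : 𝔼) hc] with v hv
    rw [mem_ball_zero_iff] at hv
    rw [norm_mul, norm_norm]
    gcongr

lemma continuousAt_gradient (h : BdryDistRegular Ω r K e) (hΩ : IsOpen Ω)
    (hF : (frontier Ω).Nonempty) {x : 𝔼} (hx : x ∈ Ω) (hxr : bdryDist Ω x < r) :
    ContinuousAt e x := by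
  have h1 : ∀ᶠ y in 𝓝 x, bdryDist Ω y < r :=
    continuous_bdryDist.continuousAt.eventually (gt_mem_nhds hxr)
  have h2 : ∀ᶠ y in 𝓝 x, 2 * ‖y - x‖ < bdryDist Ω x := by
    have : ContinuousAt (fun y : 𝔼 => 2 * ‖y - x‖) x := by fun_prop
    exact this.eventually (gt_mem_nhds (by simpa using bdryDist_pos hΩ hF hx))
  rw [ContinuousAt, tendsto_iff_norm_sub_tendsto_zero]
  refine squeeze_zero' (Eventually.of_forall fun y => norm_nonneg (e y - e x))
    (g := fun y => 6 * K * ‖y - x‖)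
    ?_ ?_
  · filter_upwards [h1, h2] with y hy1 hy2
    have := h.norm_sub_le hΩ hx hxr hy2 (by rwa [add_sub_cancel])
    rwa [add_sub_cancel, norm_sub_rev] at this
  · have : ContinuousAt (fun y : 𝔼 => 6 * K * ‖y - x‖) x := by fun_prop
    simpa [ContinuousAt] using this

end BdryDistRegular

/-- The Laplacian, as the trace of the second derivative. -/
def lap (u : 𝔼 → ℝ) (x : 𝔼) : ℝ :=
  ∑ i, fderiv ℝ (fderiv ℝ u) x (EuclideanSpace.basisFun (Fin N) ℝ i)
    (EuclideanSpace.basisFun (Fin N) ℝ i)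

lemma norm_basisFun (i : Fin N) : ‖EuclideanSpace.basisFun (Fin N) ℝ i‖ = 1 :=
  (EuclideanSpace.basisFun (Fin N) ℝ).norm_eq_one i

lemma abs_lap_le {u : 𝔼 → ℝ} {x : 𝔼} {C : ℝ} (h : ‖fderiv ℝ (fderiv ℝ u) x‖ ≤ C) :
    |lap u x| ≤ N * C := by
  refine (Finset.abs_sum_le_sum_abs _ _).trans ?_
  have : ∀ i ∈ Finset.univ, |fderiv ℝ (fderiv ℝ u) x (EuclideanSpace.basisFun (Fin N) ℝ i)
      (EuclideanSpace.basisFun (Fin N) ℝ i)| ≤ C := fun i _ => by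
    have := (fderiv ℝ (fderiv ℝ u) x).le_opNorm₂ (EuclideanSpace.basisFun (Fin N) ℝ i)
      (EuclideanSpace.basisFun (Fin N) ℝ i)
    rw [norm_basisFun, mul_one, mul_one] at this
    exact this.trans h
  simpa using Finset.sum_le_sum this

/-- A quadratic-type increment estimate bounds the derivative. -/
lemma norm_fderiv_sub_le_of_increment {f : 𝔼 → ℝ} {f' T : 𝔼 →L[ℝ] ℝ} {x : 𝔼} {A B : ℝ}
    (hA : 0 ≤ A) (hf : HasFDerivAt f f' x)
    (h : ∀ᶠ w in 𝓝 (0 : 𝔼), |f (x + w) - f x - T w| ≤ A * ‖w‖ + B * ‖w‖ ^ 2) : ‖f' - T‖ ≤ A := by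
  refine le_of_forall_pos_le_add fun η hη => ?_
  refine (hf.sub T.hasFDerivAt).le_of_lip' (by positivity) ?_
  have h0 : Tendsto (fun y : 𝔼 => y - x) (𝓝 x) (𝓝 0) := by
    have : ContinuousAt (fun y : 𝔼 => y - x) x := by fun_prop
    simpa [ContinuousAt] using this
  have h1 : ∀ᶠ w in 𝓝 (0 : 𝔼), B * ‖w‖ < η := by
    have : ContinuousAt (fun w : 𝔼 => B * ‖w‖) 0 := by fun_prop
    exact this.eventually (gt_mem_nhds (by simpa using hη))
  filter_upwards [h0.eventually h, h0.eventually h1] with y hy1 hy2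
  rw [add_sub_cancel] at hy1
  have h3 : (f - ⇑T) y - (f - ⇑T) x = f y - f x - T (y - x) := by
    simp only [Pi.sub_apply, map_sub]; ring
  rw [h3, Real.norm_eq_abs]
  nlinarith [norm_nonneg (y - x)]

lemma abs_integral_mul_sub_le {φ : ContDiffBump (0 : 𝔼)} {F : 𝔼 → ℝ} (hF : Continuous F) {c B : ℝ}
    (h : ∀ t, ‖t‖ < φ.rOut → |F t - c| ≤ B) :
    |(∫ t, φ.normed volume t * F t) - c| ≤ B := by
  have hcs : HasCompactSupport (φ.normed volume : 𝔼 → ℝ) := φ.hasCompactSupport_normed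
  have hcont : Continuous (φ.normed volume : 𝔼 → ℝ) := φ.continuous_normed
  have hint : ∀ {F' : 𝔼 → ℝ}, Continuous F' → Integrable (fun t => φ.normed volume t * F' t) :=
    fun hF' => (hcont.mul hF').integrable_of_hasCompactSupport hcs.mul_right
  have h1 : (∫ t, φ.normed volume t * F t) - c = ∫ t, φ.normed volume t * (F t - c) := by
    simp_rw [mul_sub]
    rw [integral_sub (hint hF) (hint continuous_const), integral_mul_const, φ.integral_normed,
      one_mul]
  have h2 : B = ∫ t, φ.normed volume t * B := by
    rw [integral_mul_const, φ.integral_normed, one_mul]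
  rw [h1, h2, ← Real.norm_eq_abs]
  refine norm_integral_le_of_norm_le (hint continuous_const) (Eventually.of_forall fun t => ?_)
  rw [norm_mul, Real.norm_of_nonneg (φ.nonneg_normed t)]
  rcases lt_or_ge ‖t‖ φ.rOut with ht | ht
  · exact mul_le_mul_of_nonneg_left (h t ht) (φ.nonneg_normed t)
  · have : φ.normed volume t = 0 := by
      have : t ∉ Function.support (φ.normed volume : 𝔼 → ℝ) := by
        rw [φ.support_normed_eq, mem_ball_zero_iff, not_lt]; exact ht
      simpa using this
    simp [this]

/-- The regularization of a function by a bump. -/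
def mollify (φ : ContDiffBump (0 : 𝔼)) (g : 𝔼 → ℝ) : 𝔼 → ℝ :=
  convolution (φ.normed volume) g (ContinuousLinearMap.lsmul ℝ ℝ) volume

lemma mollify_apply (φ : ContDiffBump (0 : 𝔼)) (g : 𝔼 → ℝ) (x : 𝔼) :
    mollify φ g x = ∫ t, φ.normed volume t * g (x - t) := by
  simp [mollify, convolution_def]

lemma contDiff_mollify (φ : ContDiffBump (0 : 𝔼)) {g : 𝔼 → ℝ} (hg : LocallyIntegrable g volume) :
    ContDiff ℝ ∞ (mollify φ g) :=
  φ.hasCompactSupport_normed.contDiff_convolution_left _ φ.contDiff_normed hg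

/-- Mollification averages increments of δ, so first and second differences inherit the Taylor and
Lipschitz bounds without differentiating under the integral. The first two bounds shrink with the
radius; the Laplacian bound does not, but is independent of it. -/
lemma mollify_bdryDist_estimates {r K : ℝ} {e : 𝔼 → 𝔼} (h : BdryDistRegular Ω r K e)
    (hΩ : IsOpen Ω) (φ : ContDiffBump (0 : 𝔼)) {x : 𝔼} (hx : x ∈ Ω)
    (hx1 : 8 * φ.rOut ≤ bdryDist Ω x) (hx2 : bdryDist Ω x + 8 * φ.rOut < r) :
    |mollify φ (bdryDist Ω) x - bdryDist Ω x| ≤ φ.rOut ∧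
    ‖fderiv ℝ (mollify φ (bdryDist Ω)) x - innerSL ℝ (e x)‖ ≤ 6 * K * φ.rOut ∧
    |lap (mollify φ (bdryDist Ω)) x| ≤ N * (6 * K) := by
  set ε := φ.rOut with hε
  have hε0 : 0 < ε := φ.rOut_pos
  have hK := h.pos
  set D := mollify φ (bdryDist Ω) with hD
  have hcd : Continuous (bdryDist Ω) := continuous_bdryDist
  have hcs : HasCompactSupport (φ.normed volume : 𝔼 → ℝ) := φ.hasCompactSupport_normed
  have hcont : Continuous (φ.normed volume : 𝔼 → ℝ) := φ.continuous_normed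
  have hint : ∀ {F' : 𝔼 → ℝ}, Continuous F' → Integrable (fun t => φ.normed volume t * F' t) :=
    fun hF' => (hcont.mul hF').integrable_of_hasCompactSupport hcs.mul_right
  have hDs : ContDiff ℝ ∞ D := contDiff_mollify φ hcd.locallyIntegrable
  have hDd : ∀ y, HasFDerivAt D (fderiv ℝ D y) y := fun y =>
    (hDs.differentiable (by simp) y).hasFDerivAt
  -- points within `4ε` of `x` stay in the good region
  have hgood : ∀ w : 𝔼, ‖w‖ < 4 * ε → x + w ∈ Ω ∧ bdryDist Ω (x + w) < r ∧
      4 * ε < bdryDist Ω (x + w) := fun w hw => by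
    have := abs_le.1 (abs_bdryDist_sub_le (Ω := Ω) (x + w) x)
    rw [add_sub_cancel_left] at this
    exact ⟨ball_bdryDist_subset hΩ hx (by
      rw [Metric.mem_ball, dist_eq_norm, add_sub_cancel_left]; linarith), by linarith [this.2],
      by linarith [this.1]⟩
  have hincr : ∀ w v : 𝔼, ‖w‖ < 3 * ε → ‖v‖ < ε →
      |bdryDist Ω (x + w + v) - bdryDist Ω (x + w) - inner ℝ (e (x + w)) v| ≤ K * ‖v‖ ^ 2 :=
    fun w v hw hv => by
      obtain ⟨h1, h2, -⟩ := hgood w (by linarith)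
      refine h.bound (x + w) h1 h2 v ?_
      rw [add_assoc]
      exact (hgood (w + v) ((norm_add_le _ _).trans_lt (by linarith))).1
  have hlip : ∀ w v : 𝔼, ‖w‖ < 3 * ε → ‖v‖ < ε → ‖e (x + w) - e (x + w + v)‖ ≤ 6 * K * ‖v‖ :=
    fun w v hw hv => by
      obtain ⟨h1, h2, h3⟩ := hgood w (by linarith)
      refine h.norm_sub_le hΩ h1 h2 (by linarith) ?_
      rw [add_assoc]
      exact (hgood (w + v) ((norm_add_le _ _).trans_lt (by linarith))).2.1
  have hballv : ∀ᶠ w : 𝔼 in 𝓝 0, ‖w‖ < ε := by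
    filter_upwards [Metric.ball_mem_nhds (0 : 𝔼) hε0] with w hw using mem_ball_zero_iff.1 hw
  refine ⟨?_, ?_, ?_⟩
  · rw [hD, mollify_apply]
    refine abs_integral_mul_sub_le (by fun_prop) fun t ht => ?_
    refine (abs_bdryDist_sub_le _ _).trans ?_
    rw [sub_sub_cancel_left, norm_neg]; exact ht.le
  · refine norm_fderiv_sub_le_of_increment (B := K) (by positivity) (hDd x) ?_
    filter_upwards [hballv] with w hw
    have h1 : D (x + w) - D x =
        ∫ t, φ.normed volume t * (bdryDist Ω (x + w - t) - bdryDist Ω (x - t)) := by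
      simp_rw [mul_sub]
      rw [integral_sub (hint (by fun_prop)) (hint (by fun_prop)), hD, mollify_apply, mollify_apply]
    rw [h1, innerSL_apply_apply]
    refine abs_integral_mul_sub_le (by fun_prop) fun t ht => ?_
    have h2 := abs_le.1 (hincr (-t) w (by rw [norm_neg]; linarith) hw)
    have h3 := hlip 0 (-t) (by simpa using hε0) (by rwa [norm_neg])
    rw [add_zero, norm_neg, ← sub_eq_add_neg] at h3
    rw [← sub_eq_add_neg, sub_add_eq_add_sub] at h2
    have h4 := abs_le.1 (abs_real_inner_le_norm (e x - e (x - t)) w)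
    rw [inner_sub_left] at h4
    have h5 : ‖e x - e (x - t)‖ * ‖w‖ ≤ 6 * K * ε * ‖w‖ :=
      mul_le_mul_of_nonneg_right (h3.trans (by gcongr)) (norm_nonneg _)
    rw [abs_le]
    constructor <;> linarith [h2.1, h2.2, h4.1, h4.2]
  · refine abs_lap_le ?_
    have h0 : HasFDerivAt (fderiv ℝ D) (fderiv ℝ (fderiv ℝ D) x) x :=
      ((hDs.fderiv_right (m := ∞) (by simp)).differentiable (by simp)
        x).hasFDerivAt
    refine h0.le_of_lip' (by positivity) ?_
    filter_upwards [Metric.ball_mem_nhds x hε0] with y hy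
    obtain ⟨v, rfl⟩ : ∃ v, y = x + v := ⟨y - x, by abel⟩
    rw [Metric.mem_ball, dist_eq_norm, add_sub_cancel_left] at hy
    rw [add_sub_cancel_left]
    have h1 : HasFDerivAt (fun z => D (z + v)) (fderiv ℝ D (x + v)) x := by
      have := (hDd (x + v)).comp x ((hasFDerivAt_id x).add_const v)
      rwa [ContinuousLinearMap.comp_id] at this
    have h2 := norm_fderiv_sub_le_of_increment (f := fun z => D z - D (z + v)) (T := 0)
      (A := 6 * K * ‖v‖) (B := 2 * K) (by positivity) ((hDd x).sub h1) ?_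
    · rwa [sub_zero, norm_sub_rev] at h2
    · filter_upwards [hballv] with w hw
      rw [zero_apply]
      -- A mixed second difference of size 6K‖v‖‖w‖ + O(‖w‖²) shows that the gradient of D is
      -- 6K-Lipschitz near x.
      have h3 : D (x + w) - D (x + w + v) - (D x - D (x + v)) - 0 =
          (∫ t, φ.normed volume t * ((bdryDist Ω (x + w - t) - bdryDist Ω (x - t)) -
            (bdryDist Ω (x + w + v - t) - bdryDist Ω (x + v - t)))) - 0 := by
        simp_rw [mul_sub]
        rw [integral_sub, integral_sub, integral_sub, hD]
        · simp only [mollify_apply]; ring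
        any_goals exact hint (by fun_prop)
        · exact (hint (by fun_prop)).sub (hint (by fun_prop))
        · exact (hint (by fun_prop)).sub (hint (by fun_prop))
      rw [h3]
      refine abs_integral_mul_sub_le (by fun_prop) fun t ht => ?_
      have ht' : ‖-t‖ < ε := by rwa [norm_neg]
      have h4 := abs_le.1 (hincr (-t) w (by linarith) hw)
      have h5 := abs_le.1 (hincr (-t + v) w ((norm_add_le _ _).trans_lt (by linarith)) hw)
      have h6 := hlip (-t) v (by linarith) hy
      have e1 : x + -t + w = x + w - t := by abel
      have e2 : x + (-t + v) + w = x + w + v - t := by abel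
      have e3 : x + -t + v = x + v - t := by abel
      have e4 : x + (-t + v) = x + v - t := by abel
      have e5 : x + -t = x - t := by abel
      rw [e1, e5] at h4
      rw [e2, e4] at h5
      rw [e3, e5] at h6
      have h7 := abs_le.1 (abs_real_inner_le_norm (e (x - t) - e (x + v - t)) w)
      rw [inner_sub_left] at h7
      have h8 := mul_le_mul_of_nonneg_right h6 (norm_nonneg w)
      rw [sub_zero, abs_le]
      constructor <;> linarith [h4.1, h4.2, h5.1, h5.2, h7.1, h7.2]

end Mollification

/-! ### Smooth approximation of radial functions. -/

section Composition

variable {N : ℕ} {Ω : Set (EuclideanSpace ℝ (Fin N))}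

local notation "𝔼" => EuclideanSpace ℝ (Fin N)

lemma sum_sq_apply_basisFun (T : 𝔼 →L[ℝ] ℝ) :
    ∑ i, T (EuclideanSpace.basisFun (Fin N) ℝ i) ^ 2 = ‖T‖ ^ 2 := by
  have := (EuclideanSpace.basisFun (Fin N) ℝ).sum_sq_inner_left
    ((InnerProductSpace.toDual ℝ 𝔼).symm T)
  simpa only [InnerProductSpace.toDual_symm_apply, LinearIsometryEquiv.norm_map] using this

lemma bdryDist_pos_of_subset (hΩ : IsOpen Ω) (hF : (frontier Ω).Nonempty) {Z : Set 𝔼} {r : ℝ}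
    (hZ : Z ⊆ bdryStrip Ω r) : ∀ x ∈ Z, 0 < bdryDist Ω x := fun _ hx => bdryDist_pos hΩ hF (hZ hx).1

lemma exists_smooth_bdryDist {r K : ℝ} {e : 𝔼 → 𝔼} (h : BdryDistRegular Ω r K e)
    (hΩ : IsOpen Ω) (hF : (frontier Ω).Nonempty) {Z : Set 𝔼} (hZ : IsCompact Z)
    (hZr : Z ⊆ bdryStrip Ω r) {τ : ℝ} (hτ : 0 < τ) :
    ∃ D : 𝔼 → ℝ, ContDiff ℝ ∞ D ∧ ∀ x ∈ Z, |D x - bdryDist Ω x| ≤ τ ∧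
      ‖fderiv ℝ D x - innerSL ℝ (e x)‖ ≤ τ ∧ |lap D x| ≤ N * (6 * K) := by
  have hK := h.pos
  obtain ⟨a, ha, haZ⟩ := hZ.exists_forall_le' (f := bdryDist Ω) (a := 0)
    continuous_bdryDist.continuousOn (bdryDist_pos_of_subset hΩ hF hZr)
  obtain ⟨b, hb, hbZ⟩ := hZ.exists_forall_le' (f := fun x => r - bdryDist Ω x) (a := 0)
    (continuous_const.sub continuous_bdryDist).continuousOn fun x hx => sub_pos.2 (hZr hx).2
  set ε := min (min (a / 8) (b / 9)) (min τ (τ / (6 * K))) with hε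
  have hε0 : 0 < ε := by positivity
  have h1 : ε ≤ a / 8 := (min_le_left _ _).trans (min_le_left _ _)
  have h2 : ε ≤ b / 9 := (min_le_left _ _).trans (min_le_right _ _)
  have h3 : ε ≤ τ := (min_le_right _ _).trans (min_le_left _ _)
  have h4 : ε ≤ τ / (6 * K) := (min_le_right _ _).trans (min_le_right _ _)
  rw [le_div_iff₀ (by positivity)] at h4
  let φ : ContDiffBump (0 : 𝔼) := ⟨ε / 2, ε, by positivity, by linarith⟩
  refine ⟨mollify φ (bdryDist Ω), contDiff_mollify φ continuous_bdryDist.locallyIntegrable,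
    fun x hx => ?_⟩
  obtain ⟨e1, e2, e3⟩ := mollify_bdryDist_estimates h hΩ φ (hZr hx).1
    (show 8 * ε ≤ _ by linarith [haZ x hx]) (show _ + 8 * ε < r by linarith [hbZ x hx])
  exact ⟨e1.trans h3, e2.trans (show 6 * K * ε ≤ τ by linarith), e3⟩

lemma hasFDerivAt_comp_of_contDiffOn {G : ℝ → ℝ} (hG : ContDiffOn ℝ ∞ G (Ioi 0)) {D : 𝔼 → ℝ}
    {D' : 𝔼 →L[ℝ] ℝ} {x : 𝔼} (hD : HasFDerivAt D D' x) (hx : 0 < D x) :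
    HasFDerivAt (G ∘ D) (deriv G (D x) • D') x :=
  ((hG.contDiffAt (Ioi_mem_nhds hx)).differentiableAt (by simp)).hasDerivAt.comp_hasFDerivAt x hD

lemma contDiffOn_deriv_Ioi {G : ℝ → ℝ} (hG : ContDiffOn ℝ ∞ G (Ioi 0)) :
    ContDiffOn ℝ ∞ (deriv G) (Ioi 0) :=
  hG.deriv_of_isOpen isOpen_Ioi (by simp)

lemma fderiv_comp_eq {G : ℝ → ℝ} (hG : ContDiffOn ℝ ∞ G (Ioi 0)) {D : 𝔼 → ℝ}
    (hD : ContDiff ℝ ∞ D) {x : 𝔼} (hx : 0 < D x) :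
    fderiv ℝ (G ∘ D) x = deriv G (D x) • fderiv ℝ D x :=
  (hasFDerivAt_comp_of_contDiffOn hG (hD.differentiable (by simp) x).hasFDerivAt hx).fderiv

lemma lap_comp_eq {G : ℝ → ℝ} (hG : ContDiffOn ℝ ∞ G (Ioi 0)) {D : 𝔼 → ℝ} (hD : ContDiff ℝ ∞ D)
    {x : 𝔼} (hx : 0 < D x) :
    lap (G ∘ D) x = deriv (deriv G) (D x) * ‖fderiv ℝ D x‖ ^ 2 + deriv G (D x) * lap D x := by
  have h1 : fderiv ℝ (G ∘ D) =ᶠ[𝓝 x] fun y => (deriv G ∘ D) y • fderiv ℝ D y := by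
    filter_upwards [hD.continuous.continuousAt.eventually (lt_mem_nhds hx)] with y hy
    exact fderiv_comp_eq hG hD hy
  have h2 : HasFDerivAt (fderiv ℝ D) (fderiv ℝ (fderiv ℝ D) x) x :=
    ((hD.fderiv_right (m := ∞) (by simp)).differentiable (by simp) x).hasFDerivAt
  have h3 := (hasFDerivAt_comp_of_contDiffOn (contDiffOn_deriv_Ioi hG)
    (hD.differentiable (by simp) x).hasFDerivAt hx).fun_smul h2
  rw [lap, h1.fderiv_eq, h3.fderiv, lap, ← sum_sq_apply_basisFun, Finset.mul_sum, Finset.mul_sum,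
    ← Finset.sum_add_distrib]
  refine Finset.sum_congr rfl fun i _ => ?_
  simp only [Function.comp_apply, add_apply, smul_apply,
    ContinuousLinearMap.smulRight_apply, smul_eq_mul]
  ring

/-- Smooth approximation of `G ∘ δ` with control of first derivatives and of the Laplacian. -/
lemma exists_smooth_comp_bdryDist {r K : ℝ} {e : 𝔼 → 𝔼} (h : BdryDistRegular Ω r K e)
    (hΩ : IsOpen Ω) (hF : (frontier Ω).Nonempty) {Z : Set 𝔼} (hZ : IsCompact Z)
    (hZr : Z ⊆ bdryStrip Ω r) {G : ℝ → ℝ} (hG : ContDiffOn ℝ ∞ G (Ioi 0)) {τ : ℝ} (hτ : 0 < τ) :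
    ∃ D : 𝔼 → ℝ, ContDiff ℝ ∞ D ∧ ∀ x ∈ Z, 0 < D x ∧ |G (D x) - G (bdryDist Ω x)| ≤ τ ∧
      ‖fderiv ℝ (G ∘ D) x - deriv G (bdryDist Ω x) • innerSL ℝ (e x)‖ ≤ τ ∧
      |lap (G ∘ D) x - deriv (deriv G) (bdryDist Ω x)| ≤
        N * (6 * K) * |deriv G (bdryDist Ω x)| + τ := by
  have hK := h.pos
  have hpos := bdryDist_pos_of_subset hΩ hF hZr
  have hG1 := contDiffOn_deriv_Ioi hG
  have hG2 := contDiffOn_deriv_Ioi hG1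
  set S := bdryDist Ω '' Z with hS
  have hSc : IsCompact S := hZ.image continuous_bdryDist
  have hSpos : ∀ t ∈ S, 0 < t := by rintro _ ⟨x, hx, rfl⟩; exact hpos x hx
  -- The point t' may lie off S, because D takes values outside the range of δ on Z.
  have hunif : ∀ {F : ℝ → ℝ}, ContDiffOn ℝ ∞ F (Ioi 0) → ∀ c > 0, ∃ η > 0, ∀ t ∈ S, ∀ t',
      |t' - t| < η → |F t' - F t| < c := by
    intro F hF c hc
    have := hSc.uniformContinuousAt_of_continuousAt F
      (fun t ht => (hF.contDiffAt (Ioi_mem_nhds (hSpos t ht))).continuousAt)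
      (Metric.dist_mem_uniformity hc)
    obtain ⟨η, hη, hη2⟩ := Metric.mem_uniformity_dist.1 this
    refine ⟨η, hη, fun t ht t' htt => ?_⟩
    have h3 := hη2 (show dist t t' < η by rwa [dist_comm, Real.dist_eq]) ht
    rwa [mem_ofPred_eq, dist_comm, Real.dist_eq] at h3
  have hbdd : ∀ {F : ℝ → ℝ}, ContDiffOn ℝ ∞ F (Ioi 0) → ∃ M, 0 ≤ M ∧ ∀ t ∈ S, |F t| ≤ M := by
    intro F hF
    obtain ⟨M, hM⟩ := hSc.exists_bound_of_continuousOn (f := F)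
      (hF.continuousOn.mono fun t ht => hSpos t ht)
    exact ⟨max M 0, le_max_right _ _, fun t ht => (hM t ht).trans (le_max_left _ _)⟩
  obtain ⟨M1, hM1, hM1S⟩ := hbdd hG1
  obtain ⟨M2, hM2, hM2S⟩ := hbdd hG2
  set K' : ℝ := N * (6 * K) with hK'
  have hK'0 : 0 ≤ K' := by positivity
  -- The denominator dominates the errors below: (2 + M1)τ' for the gradient and (4 + 3 M2 + K')τ'
  -- for the Laplacian.
  set τ' := min 1 (τ / (4 + M1 + 3 * M2 + K')) with hτ'
  have hτ'0 : 0 < τ' := by positivity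
  have hτ1 : τ' ≤ 1 := min_le_left _ _
  have hτ2 : τ' * (4 + M1 + 3 * M2 + K') ≤ τ := by
    rw [← le_div_iff₀ (by positivity)]; exact min_le_right _ _
  obtain ⟨a, ha, haS⟩ := hZ.exists_forall_le' (f := bdryDist Ω) (a := 0)
    continuous_bdryDist.continuousOn hpos
  obtain ⟨η0, hη0, h0⟩ := hunif hG τ' hτ'0
  obtain ⟨η1, hη1, h1⟩ := hunif hG1 τ' hτ'0
  obtain ⟨η2, hη2, h2⟩ := hunif hG2 τ' hτ'0
  set η := min (min η0 η1) (min η2 (min a τ')) / 2 with hη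
  have hηpos : 0 < min (min η0 η1) (min η2 (min a τ')) := by positivity
  obtain ⟨D, hD, hDZ⟩ := exists_smooth_bdryDist h hΩ hF hZ hZr (half_pos hηpos)
  refine ⟨D, hD, fun x hx => ?_⟩
  obtain ⟨d1, d2, d3⟩ := hDZ x hx
  have hm : ∀ c, min (min η0 η1) (min η2 (min a τ')) ≤ c → |D x - bdryDist Ω x| < c := fun c hc =>
    by linarith
  have hxS : bdryDist Ω x ∈ S := mem_image_of_mem _ hx
  have hDx : 0 < D x := by
    have := hm a ((min_le_right _ _).trans ((min_le_right _ _).trans (min_le_left _ _)))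
    linarith [(abs_lt.1 this).1, haS x hx]
  have b0 := h0 _ hxS _ (hm η0 ((min_le_left _ _).trans (min_le_left _ _)))
  have b1 := h1 _ hxS _ (hm η1 ((min_le_left _ _).trans (min_le_right _ _)))
  have b2 := h2 _ hxS _ (hm η2 ((min_le_right _ _).trans (min_le_left _ _)))
  have bT : ‖fderiv ℝ D x - innerSL ℝ (e x)‖ ≤ τ' := by
    have : min (min η0 η1) (min η2 (min a τ')) ≤ τ' :=
      (min_le_right _ _).trans ((min_le_right _ _).trans (min_le_right _ _))
    linarith
  have he : ‖innerSL ℝ (e x)‖ = 1 := by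
    rw [innerSL_apply_norm, h.norm_eq x (hZr hx).1 (hZr hx).2]
  have hTl := (abs_le.1 ((abs_norm_sub_norm_le (fderiv ℝ D x) (innerSL ℝ (e x))).trans bT))
  rw [he] at hTl
  set q := ‖fderiv ℝ D x‖ with hq
  have hq0 : 0 ≤ q := norm_nonneg _
  set t := bdryDist Ω x with ht
  have m1 := hM1S t hxS
  have m2 := hM2S t hxS
  refine ⟨hDx, by nlinarith, ?_, ?_⟩
  · rw [fderiv_comp_eq hG hD hDx]
    have : deriv G (D x) • fderiv ℝ D x - deriv G t • innerSL ℝ (e x) =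
        (deriv G (D x) - deriv G t) • fderiv ℝ D x
          + deriv G t • (fderiv ℝ D x - innerSL ℝ (e x)) := by module
    rw [this]
    refine (norm_add_le _ _).trans ?_
    rw [norm_smul, norm_smul, Real.norm_eq_abs, Real.norm_eq_abs]
    have c1 : |deriv G (D x) - deriv G t| * q ≤ τ' * 2 :=
      mul_le_mul b1.le (by linarith [hTl.2]) hq0 hτ'0.le
    have c2 : |deriv G t| * ‖fderiv ℝ D x - innerSL ℝ (e x)‖ ≤ M1 * τ' :=
      mul_le_mul m1 bT (norm_nonneg _) hM1
    have : 0 ≤ τ' * (3 * M2) := by positivity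
    have : 0 ≤ τ' * K' := by positivity
    linarith
  · rw [lap_comp_eq hG hD hDx, ← hq]
    -- All terms are small except the last, where the Laplacian of D is merely bounded; it is the
    -- source of the first-order error N(6K)|G'|.
    have : deriv (deriv G) (D x) * q ^ 2 + deriv G (D x) * lap D x - deriv (deriv G) t =
        (deriv (deriv G) (D x) - deriv (deriv G) t) * q ^ 2 + deriv (deriv G) t * (q ^ 2 - 1)
        + (deriv G (D x) - deriv G t) * lap D x + deriv G t * lap D x := by ring
    rw [this]
    refine (abs_add_le _ _).trans ((add_le_add (abs_add_le _ _) le_rfl).trans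
      ((add_le_add (add_le_add (abs_add_le _ _) le_rfl) le_rfl).trans ?_))
    simp only [abs_mul, abs_of_nonneg (sq_nonneg q)]
    have hq2 : q ^ 2 ≤ 4 := by nlinarith [hTl.2]
    have hq3 : |q ^ 2 - 1| ≤ 3 * τ' := by
      rw [abs_le]; constructor <;> nlinarith [hTl.1, hTl.2]
    have c1 : |deriv (deriv G) (D x) - deriv (deriv G) t| * q ^ 2 ≤ τ' * 4 :=
      mul_le_mul b2.le hq2 (sq_nonneg _) hτ'0.le
    have c2 : |deriv (deriv G) t| * |q ^ 2 - 1| ≤ M2 * (3 * τ') :=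
      mul_le_mul m2 hq3 (abs_nonneg _) hM2
    have c3 : |deriv G (D x) - deriv G t| * |lap D x| ≤ τ' * K' :=
      mul_le_mul b1.le d3 (abs_nonneg _) hτ'0.le
    have c4 : |deriv G t| * |lap D x| ≤ |deriv G t| * K' :=
      mul_le_mul_of_nonneg_left d3 (abs_nonneg _)
    have : 0 ≤ τ' * M1 := by positivity
    linarith

end Composition

/-! ### Weak gradients and the distributional inequality. -/

section Weak

variable {N : ℕ} {Ω : Set (EuclideanSpace ℝ (Fin N))}

local notation "𝔼" => EuclideanSpace ℝ (Fin N)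

lemma memLp_restrict_of_continuousOn {F : Type*} [NormedAddCommGroup F] {f : 𝔼 → F}
    {K : Set 𝔼} (hK : IsCompact K) (hf : ContinuousOn f K) :
    MemLp f 2 (volume.restrict K) := by
  obtain ⟨C, hC⟩ := hK.exists_bound_of_continuousOn hf
  have : IsFiniteMeasure (volume.restrict K) := ⟨by simpa using hK.measure_lt_top⟩
  exact MemLp.of_bound (hf.aestronglyMeasurable_of_isCompact hK hK.measurableSet) C (ae_restrict_of_forall_mem hK.measurableSet hC)

lemma integrable_restrict_of_memLp {F : Type*} [NormedAddCommGroup F] {f : 𝔼 → F}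
    {K : Set 𝔼} (hK : IsCompact K) (hf : MemLp f 2 (volume.restrict K)) :
    Integrable f (volume.restrict K) := by
  have : IsFiniteMeasure (volume.restrict K) := ⟨by simpa using hK.measure_lt_top⟩
  exact hf.integrable (by norm_num)

lemma continuous_mul_of_tsupport_subset {U : Set 𝔼} (hU : IsOpen U) {u φ : 𝔼 → ℝ}
    (hu : ContinuousOn u U) (hφ : Continuous φ) (hs : tsupport φ ⊆ U) :
    Continuous fun x => u x * φ x := by
  refine continuous_of_tsupport fun x hx => ?_
  have hx' : x ∈ tsupport φ := closure_mono (fun y hy => by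
    simp only [Function.mem_support] at hy ⊢; exact right_ne_zero_of_mul hy) hx
  exact (hu.continuousAt (hU.mem_nhds (hs hx'))).mul hφ.continuousAt

lemma setIntegral_mul_eq_integral {U : Set 𝔼} {u φ : 𝔼 → ℝ} (hs : tsupport φ ⊆ U) :
    ∫ x in U, u x * φ x = ∫ x, u x * φ x :=
  setIntegral_eq_integral_of_forall_compl_eq_zero fun x hx => by
    rw [image_eq_zero_of_notMem_tsupport fun h => hx (hs h), mul_zero]

/-- A continuously differentiable function has its classical gradient as weak gradient. -/
lemma isWeakGradient_of_hasFDerivAt {U : Set 𝔼} (hU : IsOpen U) {u : 𝔼 → ℝ} {g : 𝔼 → 𝔼}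
    (hu : ∀ x ∈ U, HasFDerivAt u (innerSL ℝ (g x)) x) (hg : ContinuousOn g U) :
    IsWeakGradient U u g := by
  intro φ hφ hc hs v
  have hcu : ContinuousOn u U := fun x hx => (hu x hx).continuousAt.continuousWithinAt
  have hcφ : Continuous fun x => fderiv ℝ φ x v :=
    (hφ.continuous_fderiv (by simp)).clm_apply continuous_const
  have hsφ : tsupport (fun x => fderiv ℝ φ x v) ⊆ U := (tsupport_fderiv_apply_subset ℝ v).trans hs
  have hcg : ContinuousOn (fun x => inner ℝ (g x) v) U := hg.inner continuousOn_const
  rw [setIntegral_mul_eq_integral hsφ, setIntegral_mul_eq_integral hs]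
  have heq : (fun x => inner ℝ (g x) v * φ x) = fun x => fderiv ℝ u x v * φ x := by
    ext x
    by_cases hx : x ∈ tsupport φ
    · rw [(hu x (hs hx)).fderiv, innerSL_apply_apply]
    · rw [image_eq_zero_of_notMem_tsupport hx, mul_zero, mul_zero]
  have h1 : Integrable fun x => inner ℝ (g x) v * φ x :=
    (continuous_mul_of_tsupport_subset hU hcg hφ.continuous hs).integrable_of_hasCompactSupport
      hc.mul_left
  rw [heq] at h1 ⊢
  refine integral_mul_fderiv_eq_neg_fderiv_mul_of_integrable h1 ?_ ?_
    (fun x hx => (hu x (hs hx)).differentiableAt) (fun x _ => hφ.differentiable (by simp) x)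
  · exact (continuous_mul_of_tsupport_subset hU hcu hcφ hsφ).integrable_of_hasCompactSupport
      (hc.fderiv_apply ℝ v).mul_left
  · exact (continuous_mul_of_tsupport_subset hU hcu hφ.continuous
      hs).integrable_of_hasCompactSupport hc.mul_left

/-- The vector representing the derivative of a function. -/
def gradVec (u : 𝔼 → ℝ) (x : 𝔼) : 𝔼 := (InnerProductSpace.toDual ℝ 𝔼).symm (fderiv ℝ u x)

lemma inner_gradVec (u : 𝔼 → ℝ) (x v : 𝔼) : inner ℝ (gradVec u x) v = fderiv ℝ u x v :=
  InnerProductSpace.toDual_symm_apply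

lemma innerSL_gradVec (u : 𝔼 → ℝ) (x : 𝔼) : innerSL ℝ (gradVec u x) = fderiv ℝ u x := by
  ext v; rw [innerSL_apply_apply, inner_gradVec]

lemma isH1Compact_of_contDiff {U : Set 𝔼} (hU : IsOpen U) {φ : 𝔼 → ℝ} (hφ : ContDiff ℝ ∞ φ)
    (hc : HasCompactSupport φ) (hs : tsupport φ ⊆ U) : IsH1Compact U φ (gradVec φ) := by
  have hcg : Continuous (gradVec φ) :=
    (InnerProductSpace.toDual ℝ 𝔼).symm.continuous.comp (hφ.continuous_fderiv (by simp))
  refine ⟨(hφ.continuous.memLp_of_hasCompactSupport hc).restrict U,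
    (hcg.memLp_of_hasCompactSupport ?_).restrict U, ?_, tsupport φ, hs, hc,
    Eventually.of_forall fun x hx => image_eq_zero_of_notMem_tsupport hx⟩
  · exact (hc.fderiv ℝ).comp_left (g := (InnerProductSpace.toDual ℝ 𝔼).symm) (map_zero _)
  · exact isWeakGradient_of_hasFDerivAt hU (fun x _ => by
      rw [innerSL_gradVec]; exact (hφ.differentiable (by simp) x).hasFDerivAt) hcg.continuousOn

lemma fderiv_fderiv_apply {u : 𝔼 → ℝ} {x : 𝔼} (hu : DifferentiableAt ℝ (fderiv ℝ u) x) (v w : 𝔼) :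
    fderiv ℝ (fun y => fderiv ℝ u y v) x w = fderiv ℝ (fderiv ℝ u) x w v := by
  rw [(hu.hasFDerivAt.clm_apply (hasFDerivAt_const v x)).fderiv]; simp

lemma differentiable_fderiv {u : 𝔼 → ℝ} (hu : ContDiff ℝ ∞ u) : Differentiable ℝ (fderiv ℝ u) :=
  (hu.fderiv_right (m := ∞) (by simp)).differentiable (by simp)

lemma lap_eq_sum {u : 𝔼 → ℝ} {x : 𝔼} (hu : DifferentiableAt ℝ (fderiv ℝ u) x) :
    lap u x = ∑ i, fderiv ℝ (fun y => fderiv ℝ u y (EuclideanSpace.basisFun (Fin N) ℝ i)) x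
      (EuclideanSpace.basisFun (Fin N) ℝ i) := by
  simp_rw [fderiv_fderiv_apply hu]; rfl

lemma tsupport_lap_subset (u : 𝔼 → ℝ) : tsupport (lap u) ⊆ tsupport u := by
  refine closure_minimal (fun x hx => ?_) (isClosed_tsupport u)
  by_contra hcon
  refine hx ?_
  have : fderiv ℝ (fderiv ℝ u) x = 0 := image_eq_zero_of_notMem_tsupport fun h =>
    hcon (tsupport_fderiv_subset ℝ (tsupport_fderiv_subset ℝ h))
  simp [lap, this]

lemma integrable_inner_mul {U : Set 𝔼} (hU : IsOpen U) {h : 𝔼 → ℝ} {g : 𝔼 → 𝔼}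
    (hg : IsH1Loc U h g) {φ : 𝔼 → ℝ} (hφ : Continuous φ) (hc : HasCompactSupport φ)
    (hs : tsupport φ ⊆ U) (v : 𝔼) :
    Integrable (fun x => inner ℝ (g x) v * φ x) (volume.restrict U) := by
  have h1 : Integrable g (volume.restrict (tsupport φ)) :=
    integrable_restrict_of_memLp hc (hg.memLp_grad _ hs hc)
  obtain ⟨C, hC⟩ := hφ.bounded_above_of_compact_support hc
  have h2 : IntegrableOn (fun x => inner ℝ (g x) v * φ x) (tsupport φ) :=
    (h1.inner_const v).mul_bdd (c := C) hφ.aestronglyMeasurable (Eventually.of_forall hC)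
  refine (h2.of_forall_sdiff_eq_zero hU.measurableSet fun x hx => ?_)
  rw [image_eq_zero_of_notMem_tsupport hx.2, mul_zero]

/-- A super-harmonic satisfies the distributional inequality. -/
lemma IsSuperHarmonic.integral_mul_lap_le {μ : ℝ} {U : Set 𝔼} (hU : IsOpen U) {h : 𝔼 → ℝ}
    (hh : IsSuperHarmonic Ω μ U h) {φ : 𝔼 → ℝ} (hφ : ContDiff ℝ ∞ φ) (hc : HasCompactSupport φ)
    (hs : tsupport φ ⊆ U) (hpos : ∀ x, 0 ≤ φ x) :
    ∫ x in U, h x * lap φ x ≤ - ∫ x in U, μ / bdryDist Ω x ^ 2 * h x * φ x := by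
  obtain ⟨hcont, g, hg, hineq⟩ := hh
  have h1 := hineq φ (gradVec φ) (isH1Compact_of_contDiff hU hφ hc hs) (Eventually.of_forall hpos)
  set b := EuclideanSpace.basisFun (Fin N) ℝ with hb
  have hsm : ∀ i, ContDiff ℝ ∞ fun x => fderiv ℝ φ x (b i) := fun i =>
    (hφ.fderiv_right (m := ∞) (by simp)).clm_apply contDiff_const
  have hcs : ∀ i, HasCompactSupport fun x => fderiv ℝ φ x (b i) := fun i => hc.fderiv_apply ℝ _
  have hts : ∀ i, tsupport (fun x => fderiv ℝ φ x (b i)) ⊆ U := fun i =>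
    (tsupport_fderiv_apply_subset ℝ _).trans hs
  -- Weak gradients are tested against scalar functions in a fixed direction, so the pairing is
  -- split along a basis and each partial derivative of φ serves as a test function.
  have h2 : ∫ x in U, inner ℝ (g x) (gradVec φ x) =
      ∑ i, ∫ x in U, inner ℝ (g x) (b i) * fderiv ℝ φ x (b i) := by
    rw [← integral_finsetSum _ fun i _ =>
      integrable_inner_mul hU hg (hsm i).continuous (hcs i) (hts i) (b i)]
    refine integral_congr_ae (Eventually.of_forall fun x => ?_)
    simp only
    rw [← b.sum_inner_mul_inner]
    refine Finset.sum_congr rfl fun i _ => ?_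
    rw [real_inner_comm (gradVec φ x), inner_gradVec]
  have h3 : ∫ x in U, h x * lap φ x = ∑ i, ∫ x in U, h x *
      fderiv ℝ (fun y => fderiv ℝ φ y (b i)) x (b i) := by
    rw [← integral_finsetSum]
    · refine integral_congr_ae (Eventually.of_forall fun x => ?_)
      simp only
      rw [lap_eq_sum (differentiable_fderiv hφ x), Finset.mul_sum]
    · intro i _
      exact ((continuous_mul_of_tsupport_subset hU hcont
        (((hsm i).continuous_fderiv (by simp)).clm_apply continuous_const)
        ((tsupport_fderiv_apply_subset ℝ _).trans (hts i))).integrable_of_hasCompactSupport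
        ((hcs i).fderiv_apply ℝ (b i)).mul_left).restrict
  rw [h3, Finset.sum_congr rfl fun i _ => hg.weakGradient _ (hsm i) (hcs i) (hts i) (b i),
    Finset.sum_neg_distrib, ← h2]
  linarith

end Weak

/-! ### Mollification of super-harmonics. -/

section SuperHarmonicMollification

variable {N : ℕ} {Ω : Set (EuclideanSpace ℝ (Fin N))}

local notation "𝔼" => EuclideanSpace ℝ (Fin N)

lemma fderiv_convolution_apply {ρ g : 𝔼 → ℝ} (hρ : ContDiff ℝ ∞ ρ) (hc : HasCompactSupport ρ)
    (hg : LocallyIntegrable g volume) (v : 𝔼) :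
    (fun x => fderiv ℝ (convolution ρ g (ContinuousLinearMap.lsmul ℝ ℝ) volume) x v) =
      convolution (fun t => fderiv ℝ ρ t v) g (ContinuousLinearMap.lsmul ℝ ℝ) volume := by
  ext x
  rw [(hc.hasFDerivAt_convolution_left (ContinuousLinearMap.lsmul ℝ ℝ)
    (hρ.of_le (by exact mod_cast le_top)) hg x).fderiv, convolution_def,
    ContinuousLinearMap.integral_apply]
  · simp [convolution_def, ContinuousLinearMap.precompL_apply]
  · exact (hc.fderiv ℝ).convolutionExists_left _ (hρ.continuous_fderiv (by simp)) hg x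

lemma integrable_mul_comp_sub {ρ g : 𝔼 → ℝ} (hρ : Continuous ρ) (hc : HasCompactSupport ρ)
    (hg : LocallyIntegrable g volume) (x : 𝔼) : Integrable fun t => ρ t * g (x - t) :=
  hc.convolutionExists_left (ContinuousLinearMap.lsmul ℝ ℝ) hρ hg x

/-- Both derivatives fall on the kernel, since g is only locally integrable. -/
lemma lap_convolution {ρ g : 𝔼 → ℝ} (hρ : ContDiff ℝ ∞ ρ) (hc : HasCompactSupport ρ)
    (hg : LocallyIntegrable g volume) (x : 𝔼) :
    lap (convolution ρ g (ContinuousLinearMap.lsmul ℝ ℝ) volume) x =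
      ∫ t, lap ρ t * g (x - t) := by
  have hsm : ContDiff ℝ ∞ (convolution ρ g (ContinuousLinearMap.lsmul ℝ ℝ) volume) :=
    hc.contDiff_convolution_left _ hρ hg
  have hρi : ∀ v : 𝔼, ContDiff ℝ ∞ fun t => fderiv ℝ ρ t v := fun v =>
    (hρ.fderiv_right (m := ∞) (by simp)).clm_apply contDiff_const
  rw [lap_eq_sum (differentiable_fderiv hsm x)]
  simp_rw [fderiv_convolution_apply hρ hc hg]
  have h1 : ∀ v : 𝔼, fderiv ℝ (convolution (fun t => fderiv ℝ ρ t v) g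
      (ContinuousLinearMap.lsmul ℝ ℝ) volume) x v =
      ∫ t, fderiv ℝ (fun s => fderiv ℝ ρ s v) t v * g (x - t) := fun v => by
    have := congrFun (fderiv_convolution_apply (hρi v) (hc.fderiv_apply ℝ v) hg v) x
    simpa [convolution_def] using this
  simp_rw [h1]
  rw [← integral_finsetSum]
  · refine integral_congr_ae (Eventually.of_forall fun t => ?_)
    simp only
    rw [lap_eq_sum (differentiable_fderiv hρ t), Finset.sum_mul]
  · intro i _
    exact integrable_mul_comp_sub (((hρi _).continuous_fderiv (by simp)).clm_apply continuous_const)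
      ((hc.fderiv_apply ℝ _).fderiv_apply ℝ _) hg x

lemma fderiv_comp_const_sub' {F : Type*} [NormedAddCommGroup F] [NormedSpace ℝ F] {ρ : 𝔼 → F}
    (hρ : Differentiable ℝ ρ) (x y : 𝔼) : fderiv ℝ (fun z => ρ (x - z)) y = -fderiv ℝ ρ (x - y) := by
  have h1 : HasFDerivAt (fun z : 𝔼 => x - z) (-(ContinuousLinearMap.id ℝ 𝔼)) y :=
    (hasFDerivAt_id y).const_sub x
  have h2 := ((hρ (x - y)).hasFDerivAt.comp y h1).fderiv
  rw [show (fun z => ρ (x - z)) = ρ ∘ fun z => x - z from rfl, h2]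
  ext v; simp

lemma lap_comp_const_sub {ρ : 𝔼 → ℝ} (hρ : ContDiff ℝ ∞ ρ) (x y : 𝔼) :
    lap (fun z => ρ (x - z)) y = lap ρ (x - y) := by
  have h1 : fderiv ℝ (fun z => ρ (x - z)) = fun z => (-fderiv ℝ ρ) (x - z) := by
    ext1 z; rw [fderiv_comp_const_sub' (hρ.differentiable (by simp))]; rfl
  rw [lap, h1]
  simp_rw [fderiv_comp_const_sub' (differentiable_fderiv hρ).neg, fderiv_neg, neg_neg]
  rfl

lemma abs_mollify_sub_le (φ : ContDiffBump (0 : 𝔼)) {g : 𝔼 → ℝ} (hg : LocallyIntegrable g volume)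
    {x : 𝔼} {c B : ℝ} (h : ∀ t, ‖t‖ < φ.rOut → |g (x - t) - c| ≤ B) :
    |mollify φ g x - c| ≤ B := by
  rcases lt_or_ge B 0 with hB | hB
  · exact absurd ((abs_nonneg _).trans (h 0 (by simpa using φ.rOut_pos))) (not_le.2 hB)
  have := dist_convolution_le (f := φ.normed volume) (g := g) (x₀ := x) (z₀ := c) (μ := volume) hB
    φ.support_normed_eq.subset φ.nonneg_normed φ.integral_normed hg.aestronglyMeasurable
    (fun y hy => by
      rw [Metric.mem_ball, dist_eq_norm, norm_sub_rev] at hy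
      simpa [Real.dist_eq] using h (x - y) hy)
  rwa [Real.dist_eq] at this

/-- A super-harmonic is locally uniformly approximated by smooth functions which are almost
classical super-solutions. -/
lemma IsSuperHarmonic.exists_smooth_approx {μ : ℝ} {U : Set 𝔼} (hU : IsOpen U)
    (hUpos : ∀ x ∈ U, 0 < bdryDist Ω x) {h : 𝔼 → ℝ} (hh : IsSuperHarmonic Ω μ U h) {Z : Set 𝔼}
    (hZ : IsCompact Z) (hZU : Z ⊆ U) {τ : ℝ} (hτ : 0 < τ) :
    ∃ H : 𝔼 → ℝ, ContDiff ℝ ∞ H ∧ ∀ x ∈ Z, |H x - h x| ≤ τ ∧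
      lap H x ≤ -(μ / bdryDist Ω x ^ 2 * h x) + τ := by
  set W : 𝔼 → ℝ := fun x => μ / bdryDist Ω x ^ 2 * h x with hW
  have hcW : ContinuousOn W U := (continuousOn_const.div (continuous_bdryDist.continuousOn.pow 2)
    fun x hx => (pow_pos (hUpos x hx) 2).ne').mul hh.1
  have hunif : ∀ {F : 𝔼 → ℝ}, ContinuousOn F U → ∃ η > 0, ∀ x ∈ Z, ∀ t : 𝔼,
      ‖t‖ < η → |F (x - t) - F x| < τ := by
    intro F hF
    have := hZ.uniformContinuousAt_of_continuousAt F
      (fun x hx => hF.continuousAt (hU.mem_nhds (hZU hx))) (Metric.dist_mem_uniformity hτ)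
    obtain ⟨η, hη, hη2⟩ := Metric.mem_uniformity_dist.1 this
    refine ⟨η, hη, fun x hx t ht => ?_⟩
    have h3 := hη2 (show dist x (x - t) < η by rwa [dist_eq_norm, sub_sub_cancel]) hx
    rwa [mem_ofPred_eq, dist_comm, Real.dist_eq] at h3
  obtain ⟨η1, hη1, hu1⟩ := hunif hh.1
  obtain ⟨η2, hη2, hu2⟩ := hunif hcW
  obtain ⟨η3, hη3, hu3⟩ := hZ.exists_cthickening_subset_open hU hZU
  set ε := min η3 (min η1 η2) with hε
  have hε0 : 0 < ε := by positivity
  -- Truncating to this compact set makes the functions globally integrable, and the mollifier at a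
  -- point of Z sees only K.
  set K := Metric.cthickening η3 Z with hK
  have hKc : IsCompact K := hZ.cthickening
  have hmemK : ∀ x ∈ Z, ∀ t : 𝔼, ‖t‖ ≤ ε → x - t ∈ K := fun x hx t ht =>
    Metric.mem_cthickening_of_dist_le _ _ _ _ hx (by
      rw [dist_eq_norm, sub_sub_cancel_left, norm_neg]; exact ht.trans (min_le_left _ _))
  have hloc : ∀ {F : 𝔼 → ℝ}, ContinuousOn F U → LocallyIntegrable (K.indicator F) volume :=
    fun hF => (((hF.mono hu3).integrableOn_compact hKc).integrable_indicator
      hKc.measurableSet).locallyIntegrable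
  let φ : ContDiffBump (0 : 𝔼) := ⟨ε / 2, ε, by positivity, by linarith⟩
  have hφs : ContDiff ℝ ∞ (φ.normed volume : 𝔼 → ℝ) := φ.contDiff_normed
  have hφc : HasCompactSupport (φ.normed volume : 𝔼 → ℝ) := φ.hasCompactSupport_normed
  have hφt : tsupport (φ.normed volume : 𝔼 → ℝ) = Metric.closedBall 0 ε := φ.tsupport_normed_eq
  refine ⟨mollify φ (K.indicator h), contDiff_mollify φ (hloc hh.1), fun x hx => ⟨?_, ?_⟩⟩
  · refine abs_mollify_sub_le φ (hloc hh.1) fun t ht => ?_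
    rw [indicator_of_mem (hmemK x hx t (le_of_lt ht))]
    exact (hu1 x hx t (lt_of_lt_of_le ht ((min_le_right _ _).trans (min_le_left _ _)))).le
  -- The reflected mollifier centred at x is an admissible test function: the distributional
  -- inequality for ψ bounds the Laplacian of the mollified h at x by minus the mollified potential
  -- term.
  · set ψ : 𝔼 → ℝ := fun y => φ.normed volume (x - y) with hψ
    have hψs : ContDiff ℝ ∞ ψ := hφs.comp (contDiff_const.sub contDiff_id)
    have hψsupp : ∀ y, y ∉ K → ψ y = 0 := fun y hy => by
      refine image_eq_zero_of_notMem_tsupport (f := φ.normed volume) (x := x - y) fun hcon => hy ?_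
      rw [hφt, mem_closedBall_zero_iff] at hcon
      simpa using hmemK x hx (x - y) hcon
    have hψt : tsupport ψ ⊆ K := closure_minimal (fun y hy => by
      by_contra hcon; exact hy (hψsupp y hcon)) hKc.isClosed
    have hψc : HasCompactSupport ψ := HasCompactSupport.of_support_subset_isCompact hKc
      (subset_closure.trans hψt)
    have h1 := hh.integral_mul_lap_le hU hψs hψc (hψt.trans hu3) fun y => φ.nonneg_normed _
    have key : ∀ {F ρ : 𝔼 → ℝ}, (∀ y, y ∉ K → ρ (x - y) = 0) →
        ∫ t, ρ t * K.indicator F (x - t) = ∫ y in U, F y * ρ (x - y) := by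
      intro F ρ hρ
      rw [setIntegral_eq_integral_of_forall_compl_eq_zero fun y hy => by
        rw [hρ y fun h => hy (hu3 h), mul_zero],
        ← integral_sub_left_eq_self _ volume x]
      refine integral_congr_ae (Eventually.of_forall fun y => ?_)
      simp only [sub_sub_cancel]
      by_cases hy : y ∈ K
      · rw [indicator_of_mem hy, mul_comm]
      · rw [hρ y hy]; simp
    have h2 : lap (mollify φ (K.indicator h)) x = ∫ y in U, h y * lap ψ y := by
      rw [mollify, lap_convolution hφs hφc (hloc hh.1), key]
      · refine integral_congr_ae (Eventually.of_forall fun y => ?_)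
        simp only [hψ, lap_comp_const_sub hφs]
      · intro y hy
        rw [← lap_comp_const_sub hφs]
        exact image_eq_zero_of_notMem_tsupport fun hcon => hy (hψt (tsupport_lap_subset _ hcon))
    have h3 : mollify φ (K.indicator W) x = ∫ y in U, W y * ψ y := by
      rw [mollify_apply, key hψsupp]
    have h4 : |mollify φ (K.indicator W) x - W x| ≤ τ := by
      refine abs_mollify_sub_le φ (hloc hcW) fun t ht => ?_
      rw [indicator_of_mem (hmemK x hx t (le_of_lt ht))]
      exact (hu2 x hx t (lt_of_lt_of_le ht ((min_le_right _ _).trans (min_le_right _ _)))).le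
    rw [h2]
    have h5 := (abs_le.1 h4).1
    rw [h3] at h5
    change _ ≤ -W x + τ
    linarith

end SuperHarmonicMollification

/-! ### Maximum principle and comparison on shells. -/

section Comparison

variable {N : ℕ} {Ω : Set (EuclideanSpace ℝ (Fin N))}

local notation "𝔼" => EuclideanSpace ℝ (Fin N)

lemma eventually_differentiableAt_of_contDiffAt {f : 𝔼 → ℝ} {x : 𝔼} (hf : ContDiffAt ℝ 2 f x) :
    ∀ᶠ y in 𝓝 x, DifferentiableAt ℝ f y :=
  (hf.eventually (by simp)).mono fun _ hy => hy.differentiableAt (by simp)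

lemma differentiableAt_fderiv_of_contDiffAt {f : 𝔼 → ℝ} {x : 𝔼} (hf : ContDiffAt ℝ 2 f x) :
    DifferentiableAt ℝ (fderiv ℝ f) x :=
  (hf.fderiv_right (m := 1) (by norm_num)).differentiableAt (by simp)

/-- The second derivative at a local maximum is nonpositive. -/
lemma fderiv_fderiv_nonpos_of_isLocalMax {f : 𝔼 → ℝ} {x : 𝔼} (hf : ContDiffAt ℝ 2 f x)
    (hmax : IsLocalMax f x) (v : 𝔼) : fderiv ℝ (fderiv ℝ f) x v v ≤ 0 := by
  set ℓ : ℝ → 𝔼 := fun t => x + t • v with hℓ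
  have hℓd : ∀ t, HasDerivAt ℓ v t := fun t => by
    have := ((hasDerivAt_id t).smul_const v).const_add x
    rwa [one_smul] at this
  have hℓ0 : ℓ 0 = x := by simp [hℓ]
  have hℓc : Tendsto ℓ (𝓝 0) (𝓝 x) := hℓ0 ▸ (hℓd 0).continuousAt.tendsto
  set g : ℝ → ℝ := f ∘ ℓ with hg
  have h1 : deriv g =ᶠ[𝓝 0] fun t => fderiv ℝ f (ℓ t) v := by
    filter_upwards [hℓc.eventually (eventually_differentiableAt_of_contDiffAt hf)] with t ht
    exact (ht.hasFDerivAt.comp_hasDerivAt t (hℓd t)).deriv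
  have h2 : deriv (deriv g) 0 = fderiv ℝ (fderiv ℝ f) x v v := by
    rw [h1.deriv_eq]
    have h3 : HasFDerivAt (fderiv ℝ f) (fderiv ℝ (fderiv ℝ f) x) (ℓ 0) :=
      hℓ0.symm ▸ (differentiableAt_fderiv_of_contDiffAt hf).hasFDerivAt
    have h4 := (h3.comp_hasDerivAt 0 (hℓd 0)).clm_apply (hasDerivAt_const 0 v)
    simpa using h4.deriv
  have hgmax : IsLocalMax g 0 := by
    have := hℓc.eventually hmax
    filter_upwards [this] with t ht
    simpa [hg, hℓ0] using ht
  rw [← h2]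
  by_contra! hpos
  have hgc : ContinuousAt g 0 :=
    ContinuousAt.comp (by rw [hℓ0]; exact hf.continuousAt) (hℓd 0).continuousAt
  -- A positive second derivative would make 0 a local minimum as well, so g would be constant near
  -- 0 with zero second derivative.
  have hmin := isLocalMin_of_deriv_deriv_pos hpos hgmax.deriv_eq_zero hgc
  have hconst : g =ᶠ[𝓝 0] fun _ => g 0 := by
    filter_upwards [hgmax, hmin] with t h5 h6 using le_antisymm h5 h6
  have := hconst.deriv.deriv_eq
  simp at this
  exact hpos.ne' this

lemma lap_nonpos_of_isLocalMax {f : 𝔼 → ℝ} {x : 𝔼} (hf : ContDiffAt ℝ 2 f x)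
    (hmax : IsLocalMax f x) : lap f x ≤ 0 :=
  Finset.sum_nonpos fun _ _ => fderiv_fderiv_nonpos_of_isLocalMax hf hmax _

lemma lap_sub_const_mul {f g : 𝔼 → ℝ} {x : 𝔼} (hf : ContDiffAt ℝ 2 f x) (hg : ContDiffAt ℝ 2 g x)
    (s : ℝ) : lap (fun y => f y - s * g y) x = lap f x - s * lap g x := by
  have h1 : fderiv ℝ (fun y => f y - s * g y) =ᶠ[𝓝 x] fun y => fderiv ℝ f y - s • fderiv ℝ g y := by
    filter_upwards [eventually_differentiableAt_of_contDiffAt hf,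
      eventually_differentiableAt_of_contDiffAt hg] with y h1 h2
    exact (h1.hasFDerivAt.sub (h2.hasFDerivAt.const_mul s)).fderiv
  have h2 := ((differentiableAt_fderiv_of_contDiffAt hf).hasFDerivAt.sub
    ((differentiableAt_fderiv_of_contDiffAt hg).hasFDerivAt.const_smul s)).fderiv
  have h3 : fderiv ℝ (fun y => fderiv ℝ f y - s • fderiv ℝ g y) x =
    fderiv ℝ (fderiv ℝ f) x - s • fderiv ℝ (fderiv ℝ g) x := h2
  simp only [lap, h1.fderiv_eq, h3, sub_apply, smul_apply, smul_eq_mul, Finset.sum_sub_distrib,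
    Finset.mul_sum]

/-- Since δ vanishes on the frontier and a > 0, the shell equals its counterpart in the closure of
Ω. -/
lemma isCompact_bdryDist_preimage_Icc (hΩ : IsOpen Ω) (hb : Bornology.IsBounded Ω) {a b : ℝ}
    (ha : 0 < a) : IsCompact {x ∈ Ω | bdryDist Ω x ∈ Icc a b} := by
  have h1 : {x ∈ Ω | bdryDist Ω x ∈ Icc a b} = closure Ω ∩ bdryDist Ω ⁻¹' Icc a b := by
    ext x
    refine ⟨fun hx => ⟨subset_closure hx.1, hx.2⟩, fun hx => ⟨?_, hx.2⟩⟩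
    by_contra hcon
    have hxF : x ∈ frontier Ω := hΩ.frontier_eq ▸ ⟨hx.1, hcon⟩
    have : bdryDist Ω x = 0 := Metric.infDist_zero_of_mem hxF
    have := hx.2.1
    linarith
  rw [h1]
  exact hb.isCompact_closure.inter_right (isClosed_Icc.preimage continuous_bdryDist)

lemma isOpen_bdryStrip (hΩ : IsOpen Ω) (ρ : ℝ) : IsOpen (bdryStrip Ω ρ) :=
  hΩ.inter (isOpen_Iio.preimage continuous_bdryDist)

/-- Comparison of a positive local super-harmonic with a strict radial sub-solution `G ∘ δ`. -/
theorem IsSuperHarmonic.comparison {μ ρ r K : ℝ} {e : 𝔼 → 𝔼} {u : 𝔼 → ℝ} (hΩ : IsOpen Ω)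
    (hb : Bornology.IsBounded Ω) (hF : (frontier Ω).Nonempty) (hreg : BdryDistRegular Ω r K e)
    (hu : IsSuperHarmonic Ω μ (bdryStrip Ω ρ) u) (hpos : ∀ x ∈ bdryStrip Ω ρ, 0 < u x)
    {a b C : ℝ} (ha : 0 < a) (hbρ : b < ρ) (hbr : b < r) (hC : 0 ≤ C) {G : ℝ → ℝ}
    (hG : ContDiffOn ℝ ∞ G (Ioi 0))
    (hsub : ∀ t ∈ Icc a b, N * (6 * K) * |deriv G t| < deriv (deriv G) t + μ / t ^ 2 * G t)
    (hbd : ∀ x ∈ Ω, bdryDist Ω x = a ∨ bdryDist Ω x = b → G (bdryDist Ω x) ≤ C * u x) :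
    ∀ x ∈ Ω, bdryDist Ω x ∈ Icc a b → G (bdryDist Ω x) ≤ C * u x := by
  set Z := {x ∈ Ω | bdryDist Ω x ∈ Icc a b} with hZ
  have hZc : IsCompact Z := isCompact_bdryDist_preimage_Icc hΩ hb ha
  have hZρ : Z ⊆ bdryStrip Ω ρ := fun x hx => ⟨hx.1, hx.2.2.trans_lt hbρ⟩
  have hZr : Z ⊆ bdryStrip Ω r := fun x hx => ⟨hx.1, hx.2.2.trans_lt hbr⟩
  have hZδ : ∀ x ∈ Z, 0 < bdryDist Ω x := fun x hx => ha.trans_le hx.2.1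
  by_contra! hcon
  obtain ⟨x₁, hx₁, hx₁Z, hlt⟩ := hcon
  have hcδ : ContinuousOn (bdryDist Ω) Z := continuous_bdryDist.continuousOn
  have hcG : ∀ {F : ℝ → ℝ}, ContDiffOn ℝ ∞ F (Ioi 0) → ContinuousOn (fun x => F (bdryDist Ω x)) Z :=
    fun hF => hF.continuousOn.comp hcδ hZδ
  have hcu : ContinuousOn u Z := hu.1.mono hZρ
  have hcV : ContinuousOn (fun x => μ / bdryDist Ω x ^ 2) Z :=
    continuousOn_const.div (hcδ.pow 2) fun x hx => (pow_pos (hZδ x hx) 2).ne'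
  obtain ⟨x₀, hx₀, hmax⟩ := hZc.exists_isMaxOn ⟨x₁, hx₁, hx₁Z⟩
    ((hcG hG).div hcu fun x hx => (hpos x (hZρ hx)).ne')
  -- Working at the maximal ratio s > C, where G∘δ - s u has maximum 0, makes the zeroth-order term
  -- negligible whatever the sign of μ.
  set s := G (bdryDist Ω x₀) / u x₀ with hs
  have hsmax : ∀ x ∈ Z, G (bdryDist Ω x) ≤ s * u x := fun x hx => by
    rw [← div_le_iff₀ (hpos x (hZρ hx))]; exact hmax hx
  have hsC : C < s := by
    refine lt_of_lt_of_le ?_ (hmax (⟨hx₁, hx₁Z⟩ : x₁ ∈ Z))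
    exact (lt_div_iff₀ (hpos x₁ (hZρ ⟨hx₁, hx₁Z⟩))).2 hlt
  have hs0 : 0 < s := hC.trans_lt hsC
  have hsx₀ : G (bdryDist Ω x₀) = s * u x₀ := by
    rw [hs, div_mul_cancel₀ _ (hpos x₀ (hZρ hx₀)).ne']
  obtain ⟨m, hm, hmZ⟩ := hZc.exists_forall_le' hcu fun x hx => hpos x (hZρ hx)
  obtain ⟨B, hBZ⟩ := hZc.exists_bound_of_continuousOn hcV
  have hB0 : 0 ≤ B := (norm_nonneg _).trans (hBZ x₀ hx₀)
  obtain ⟨c, hc, hcZ⟩ := hZc.exists_forall_le' (a := 0) (f := fun x =>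
      deriv (deriv G) (bdryDist Ω x) + μ / bdryDist Ω x ^ 2 * G (bdryDist Ω x)
        - N * (6 * K) * |deriv G (bdryDist Ω x)|)
    (((hcG (contDiffOn_deriv_Ioi (contDiffOn_deriv_Ioi hG))).add (hcV.mul (hcG hG))).sub
      (continuousOn_const.mul (hcG (contDiffOn_deriv_Ioi hG)).abs))
    fun x hx => sub_pos.2 (hsub _ hx.2)
  -- The first bound keeps the total error (1 + s)(1 + 2B)τ below the strictness margin c; the
  -- second keeps the maximum point off the two boundary levels.
  set τ := min (c / (2 * ((1 + s) * (1 + 2 * B)))) ((s - C) * m / (4 * (1 + s))) with hτ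
  have hsC' : 0 < s - C := sub_pos.2 hsC
  have hτ0 : 0 < τ := by positivity
  have hτ1 : τ * (2 * ((1 + s) * (1 + 2 * B))) ≤ c := by
    rw [← le_div_iff₀ (by positivity)]; exact min_le_left _ _
  have hτ2 : τ * (4 * (1 + s)) ≤ (s - C) * m := by
    rw [← le_div_iff₀ (by positivity)]; exact min_le_right _ _
  obtain ⟨D, hD, hDZ⟩ := exists_smooth_comp_bdryDist hreg hΩ hF hZc hZr hG hτ0
  obtain ⟨H, hH, hHZ⟩ := hu.exists_smooth_approx (isOpen_bdryStrip hΩ ρ)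
    (fun x hx => bdryDist_pos hΩ hF hx.1) hZc hZρ hτ0
  set f : 𝔼 → ℝ := fun y => (G ∘ D) y - s * H y with hf
  have hGD : ∀ x ∈ Z, ContDiffAt ℝ ∞ (G ∘ D) x := fun x hx =>
    (hG.contDiffAt (Ioi_mem_nhds (hDZ x hx).1)).comp x hD.contDiffAt
  have hfc : ContinuousOn f Z := fun x hx =>
    ((hGD x hx).continuousAt.sub (continuousAt_const.mul
      hH.continuous.continuousAt)).continuousWithinAt
  obtain ⟨x, hx, hxmax⟩ := hZc.exists_isMaxOn ⟨x₀, hx₀⟩ hfc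
  obtain ⟨-, d1, -, d3⟩ := hDZ x hx
  obtain ⟨h1, h2⟩ := hHZ x hx
  have e1 : f x₀ ≤ f x := hxmax hx₀
  have e2 : -((1 + s) * τ) ≤ f x₀ := by
    have i1 := (abs_le.1 (hDZ x₀ hx₀).2.1).1
    have i2 := mul_le_mul_of_nonneg_left (abs_le.1 (hHZ x₀ hx₀).1).2 hs0.le
    simp only [hf, Function.comp_apply]
    linarith
  have e3 : f x ≤ G (bdryDist Ω x) - s * u x + (1 + s) * τ := by
    have i1 := (abs_le.1 d1).2
    have i2 := mul_le_mul_of_nonneg_left (abs_le.1 h1).1 hs0.le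
    simp only [hf, Function.comp_apply]
    linarith
  have e4 := hsmax x hx
  -- On those levels G∘δ - s u ≤ -(s - C)m, whereas maximality of x forces it to be at least -2(1 +
  -- s)τ.
  have hint : ¬ (bdryDist Ω x = a ∨ bdryDist Ω x = b) := fun hab => by
    have i1 := hbd x hx.1 hab
    have i2 := mul_le_mul_of_nonneg_left (hmZ x hx) hsC'.le
    have i3 : 0 < (1 + s) * τ := by positivity
    linarith
  rw [not_or] at hint
  have hloc : IsLocalMax f x := by
    have hopen : IsOpen {y ∈ Ω | bdryDist Ω y ∈ Ioo a b} :=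
      hΩ.inter (isOpen_Ioo.preimage continuous_bdryDist)
    filter_upwards [hopen.mem_nhds ⟨hx.1, lt_of_le_of_ne hx.2.1 (Ne.symm hint.1),
      lt_of_le_of_ne hx.2.2 hint.2⟩] with y hy
    exact hxmax (⟨hy.1, hy.2.1.le, hy.2.2.le⟩ : y ∈ Z)
  have two_le : (2 : WithTop ℕ∞) ≤ ∞ := WithTop.coe_le_coe.2 (le_top : (2 : ℕ∞) ≤ ⊤)
  have hG2 : ContDiffAt ℝ 2 (G ∘ D) x := (hGD x hx).of_le two_le
  have hH2 : ContDiffAt ℝ 2 H x := hH.contDiffAt.of_le two_le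
  have hlap : lap (fun y => (G ∘ D) y - s * H y) x ≤ 0 :=
    lap_nonpos_of_isLocalMax (hG2.sub (contDiffAt_const.mul hH2)) hloc
  rw [lap_sub_const_mul hG2 hH2] at hlap
  have i1 := mul_le_mul_of_nonneg_left h2 hs0.le
  have i2 := (abs_le.1 d3).1
  have i3 := hcZ x hx
  set V := μ / bdryDist Ω x ^ 2 with hV
  have i4 : |V * (G (bdryDist Ω x) - s * u x)| ≤ B * (2 * ((1 + s) * τ)) := by
    rw [abs_mul]
    refine mul_le_mul (hBZ x hx) ?_ (abs_nonneg _) hB0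
    rw [abs_le]; constructor
    · linarith
    · have : 0 < (1 + s) * τ := by positivity
      linarith
  have i5 := (abs_le.1 i4).2
  have i6 : 0 < (1 + s) * τ := by positivity
  have i7 : 0 ≤ B * ((1 + s) * τ) := by positivity
  have i8 : V * (G (bdryDist Ω x) - s * u x) = V * G (bdryDist Ω x) - s * (V * u x) := by ring
  rw [i8] at i5
  linarith

end Comparison

/-! ### Radial super-solutions are super-harmonics. -/

section Existence

variable {N : ℕ} {Ω : Set (EuclideanSpace ℝ (Fin N))}

local notation "𝔼" => EuclideanSpace ℝ (Fin N)

/-- A smooth cutoff function equal to `1` near a compact subset of an open set. -/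
lemma exists_smooth_cutoff {U K : Set 𝔼} (hU : IsOpen U) (hK : IsCompact K) (hKU : K ⊆ U) :
    ∃ (χ : 𝔼 → ℝ) (K' : Set 𝔼), ContDiff ℝ ∞ χ ∧ IsCompact K' ∧ K' ⊆ U ∧ tsupport χ ⊆ K' ∧
      ∀ x ∈ K, χ =ᶠ[𝓝 x] fun _ => 1 := by
  obtain ⟨ε, hε, hεU⟩ := hK.exists_cthickening_subset_open hU hKU
  have hint : K ⊆ interior (Metric.cthickening ε K) :=
    (Metric.self_subset_thickening hε K).trans (Metric.thickening_subset_interior_cthickening ε K)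
  obtain ⟨f, hf1, hf0, -⟩ := exists_contMDiffMap_one_nhds_of_subset_interior (n := ⊤)
    (modelWithCornersSelf ℝ 𝔼) hK.isClosed hint
  refine ⟨f, Metric.cthickening ε K, f.contMDiff.contDiff, hK.cthickening, hεU, ?_, fun x hx => ?_⟩
  · refine closure_minimal (fun x hx => ?_) Metric.isClosed_cthickening
    by_contra hcon
    exact hx (hf0 x hcon)
  · exact hf1.filter_mono (nhds_le_nhdsSet hx)

/-- The weak gradient vanishes almost everywhere outside any compact set outside of which the
function vanishes. -/
lemma IsH1Compact.grad_eq_zero {U K : Set 𝔼} (hU : IsOpen U) {φ : 𝔼 → ℝ} {ψ : 𝔼 → 𝔼}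
    (h : IsH1Compact U φ ψ) (hK : IsCompact K)
    (hφK : ∀ᵐ x ∂volume.restrict U, x ∉ K → φ x = 0) :
    ∀ᵐ x ∂volume.restrict U, x ∉ K → ψ x = 0 := by
  have hUK : IsOpen (U \ K) := hU.sdiff hK.isClosed
  have hloc : ∀ v : 𝔼, LocallyIntegrableOn (fun x => inner ℝ (ψ x) v) (U \ K) volume := fun v =>
    (locallyIntegrableOn_of_locallyIntegrable_restrict
      ((h.memLp_grad.inner_const v).locallyIntegrable (by norm_num))).mono_set sdiff_subset
  have key : ∀ v : 𝔼, ∀ᵐ x ∂volume, x ∈ U \ K → inner ℝ (ψ x) v = 0 := fun v => by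
    -- Against test functions supported in U \ K the weak-gradient identity has zero left side, so
    -- every component of ψ vanishes there.
    refine hUK.ae_eq_zero_of_integral_contDiff_smul_eq_zero (hloc v) fun g hg hgc hgs => ?_
    have h1 := h.weakGradient g hg hgc (hgs.trans sdiff_subset) v
    have h2 : ∫ x in U, φ x * fderiv ℝ g x v = 0 := by
      rw [← integral_zero 𝔼 ℝ (μ := volume.restrict U)]
      refine integral_congr_ae ?_
      filter_upwards [hφK] with x hx
      by_cases hxK : x ∈ K
      · have : fderiv ℝ g x = 0 := image_eq_zero_of_notMem_tsupport fun hcon =>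
          (hgs (tsupport_fderiv_subset ℝ hcon)).2 hxK
        simp [this]
      · rw [hx hxK, zero_mul]
    rw [h2, setIntegral_mul_eq_integral (hgs.trans sdiff_subset)] at h1
    simp only [smul_eq_mul, mul_comm (g _)]
    linarith
  have key' : ∀ᵐ x ∂volume, ∀ i, x ∈ U \ K →
      inner ℝ (ψ x) (EuclideanSpace.basisFun (Fin N) ℝ i) = 0 := ae_all_iff.2 fun i => key _
  rw [ae_restrict_iff' hU.measurableSet]
  filter_upwards [key'] with x hx hxU hxK
  have h3 := (EuclideanSpace.basisFun (Fin N) ℝ).sum_sq_inner_left (ψ x)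
  rw [Finset.sum_eq_zero fun i _ => by rw [hx i ⟨hxU, hxK⟩]; norm_num] at h3
  exact norm_eq_zero.1 (pow_eq_zero_iff two_ne_zero |>.1 h3.symm)

/-- If `w` is smooth near a compact set `K'` and `χ` is a cutoff function supported there, then
testing the weak gradient of `φ` against `χ ∇w` gives Green's identity. -/
lemma IsH1Compact.green_identity {U K K' : Set 𝔼} (hUb : volume U ≠ ⊤) {φ : 𝔼 → ℝ}
    {ψ : 𝔼 → 𝔼} (h : IsH1Compact U φ ψ)
    (hφK : ∀ᵐ x ∂volume.restrict U, x ∉ K → φ x = 0)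
    (hψK : ∀ᵐ x ∂volume.restrict U, x ∉ K → ψ x = 0)
    {χ w : 𝔼 → ℝ} (hχ : ContDiff ℝ ∞ χ) (hK' : IsCompact K') (hK'U : K' ⊆ U)
    (hχs : tsupport χ ⊆ K') (hχ1 : ∀ x ∈ K, χ =ᶠ[𝓝 x] fun _ => 1)
    (hw : ∀ x ∈ K', ContDiffAt ℝ ∞ w x) :
    ∃ A B : 𝔼 → ℝ, Integrable A (volume.restrict U) ∧ Integrable B (volume.restrict U) ∧
      (A =ᵐ[volume.restrict U] fun x => K.indicator (fun x => φ x * lap w x) x) ∧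
      (B =ᵐ[volume.restrict U] fun x => K.indicator (fun x => fderiv ℝ w x (ψ x)) x) ∧
      ∫ x in U, A x = - ∫ x in U, B x := by
  have : IsFiniteMeasure (volume.restrict U) := ⟨by simpa using hUb.lt_top⟩
  set b := EuclideanSpace.basisFun (Fin N) ℝ with hb
  -- Near K, where χ = 1, these are the partial derivatives of w, so their divergence is the
  -- Laplacian; off K both φ and ψ vanish and the cutoff is invisible.
  set η : Fin N → 𝔼 → ℝ := fun i x => χ x * fderiv ℝ w x (b i) with hη
  have hsupp : ∀ i, tsupport (η i) ⊆ tsupport χ := fun i =>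
    closure_mono fun x hx => left_ne_zero_of_mul (show χ x * _ ≠ 0 from hx)
  have hηs : ∀ i, ContDiff ℝ ∞ (η i) := fun i => by
    rw [contDiff_iff_contDiffAt]
    intro x
    by_cases hx : x ∈ tsupport χ
    · exact hχ.contDiffAt.mul (((hw x (hχs hx)).fderiv_right (m := ∞) (by simp)).clm_apply
        contDiffAt_const)
    · have : η i =ᶠ[𝓝 x] fun _ => 0 := by
        filter_upwards [(isClosed_tsupport χ).isOpen_compl.mem_nhds hx] with y hy
        simp [hη, image_eq_zero_of_notMem_tsupport hy]
      exact contDiffAt_const.congr_of_eventuallyEq this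
  have hηc : ∀ i, HasCompactSupport (η i) := fun i =>
    hK'.of_isClosed_subset (isClosed_tsupport _) ((hsupp i).trans hχs)
  have hηU : ∀ i, tsupport (η i) ⊆ U := fun i => ((hsupp i).trans hχs).trans hK'U
  have hφi : Integrable φ (volume.restrict U) := h.memLp_fun.integrable (by norm_num)
  have hψi : Integrable ψ (volume.restrict U) := h.memLp_grad.integrable (by norm_num)
  have hAi : ∀ i ∈ Finset.univ, Integrable (fun x => φ x * fderiv ℝ (η i) x (b i))
      (volume.restrict U) := fun i _ => by
    have hc : Continuous fun x => fderiv ℝ (η i) x (b i) :=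
      ((hηs i).continuous_fderiv (by simp)).clm_apply continuous_const
    obtain ⟨C, hC⟩ := hc.bounded_above_of_compact_support ((hηc i).fderiv_apply ℝ (b i))
    exact hφi.mul_bdd (c := C) hc.aestronglyMeasurable (Eventually.of_forall hC)
  have hBi : ∀ i ∈ Finset.univ, Integrable (fun x => inner ℝ (ψ x) (b i) * η i x)
      (volume.restrict U) := fun i _ => by
    obtain ⟨C, hC⟩ := (hηs i).continuous.bounded_above_of_compact_support (hηc i)
    exact (hψi.inner_const (b i)).mul_bdd (c := C) (hηs i).continuous.aestronglyMeasurable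
      (Eventually.of_forall hC)
  refine ⟨fun x => ∑ i, φ x * fderiv ℝ (η i) x (b i), fun x => ∑ i, inner ℝ (ψ x) (b i) * η i x,
    integrable_finsetSum _ hAi, integrable_finsetSum _ hBi, ?_, ?_, ?_⟩
  · filter_upwards [hφK] with x hx
    by_cases hxK : x ∈ K
    · have hxK' : x ∈ K' := hχs (by
        refine subset_tsupport χ ?_
        rw [Function.mem_support, (hχ1 x hxK).self_of_nhds]
        exact one_ne_zero)
      have hd : DifferentiableAt ℝ (fderiv ℝ w) x :=
        ((hw x hxK').fderiv_right (m := ∞) (by simp)).differentiableAt (by simp)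
      rw [indicator_of_mem hxK, lap_eq_sum hd, Finset.mul_sum]
      refine Finset.sum_congr rfl fun i _ => ?_
      have : η i =ᶠ[𝓝 x] fun y => fderiv ℝ w y (b i) := by
        filter_upwards [hχ1 x hxK] with y hy
        simp [hη, hy]
      rw [this.fderiv_eq]
    · simp [hx hxK, indicator_of_notMem hxK]
  · filter_upwards [hψK] with x hx
    by_cases hxK : x ∈ K
    · rw [indicator_of_mem hxK]
      have h1 : χ x = 1 := (hχ1 x hxK).self_of_nhds
      have h2 := b.sum_inner_mul_inner (ψ x) (gradVec w x)
      rw [real_inner_comm, inner_gradVec] at h2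
      rw [← h2]
      refine Finset.sum_congr rfl fun i _ => ?_
      rw [real_inner_comm _ (b i), inner_gradVec]
      simp [hη, h1]
    · simp [hx hxK, indicator_of_notMem hxK]
  · rw [integral_finsetSum _ hAi, integral_finsetSum _ hBi, ← Finset.sum_neg_distrib]
    exact Finset.sum_congr rfl fun i _ => h.weakGradient _ (hηs i) (hηc i) (hηU i) (b i)

/-- A radial super-solution `G ∘ δ` of the one-dimensional problem is a super-harmonic. -/
theorem isSuperHarmonic_comp_bdryDist {μ ρ r K : ℝ} {e : 𝔼 → 𝔼} (hΩ : IsOpen Ω)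
    (hb : Bornology.IsBounded Ω) (hF : (frontier Ω).Nonempty) (hreg : BdryDistRegular Ω r K e)
    (hρr : ρ ≤ r) {G : ℝ → ℝ} (hG : ContDiffOn ℝ ∞ G (Ioi 0))
    (hsup : ∀ t ∈ Ioo 0 ρ,
      deriv (deriv G) t + N * (6 * K) * |deriv G t| + μ / t ^ 2 * G t ≤ 0) :
    IsSuperHarmonic Ω μ (bdryStrip Ω ρ) fun x => G (bdryDist Ω x) := by
  set U := bdryStrip Ω ρ with hUdef
  have hU : IsOpen U := isOpen_bdryStrip hΩ ρ
  have hUb : volume U ≠ ⊤ := ((hb.subset fun x hx => hx.1).measure_lt_top).ne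
  have hpos : ∀ x ∈ U, 0 < bdryDist Ω x := fun x hx => bdryDist_pos hΩ hF hx.1
  have hcδ : ContinuousOn (bdryDist Ω) U := continuous_bdryDist.continuousOn
  have hce : ContinuousOn e U := by
    intro x hx
    have h1 : bdryDist Ω x < r := lt_of_lt_of_le hx.2 hρr
    exact (hreg.continuousAt_gradient hΩ hF hx.1 h1).continuousWithinAt
  have hcG : ContinuousOn (fun x => G (bdryDist Ω x)) U := hG.continuousOn.comp hcδ hpos
  set g : 𝔼 → 𝔼 := fun x => deriv G (bdryDist Ω x) • e x with hg
  have hcg : ContinuousOn g U := ((contDiffOn_deriv_Ioi hG).continuousOn.comp hcδ hpos).smul hce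
  have hinner : ∀ x, innerSL ℝ (g x) = deriv G (bdryDist Ω x) • innerSL ℝ (e x) := fun x => by
    rw [hg, map_smul]
  have hder : ∀ x ∈ U, HasFDerivAt (fun x => G (bdryDist Ω x)) (innerSL ℝ (g x)) x := fun x hx => by
    rw [hinner]
    exact hasFDerivAt_comp_of_contDiffOn hG (hreg.hasFDerivAt hΩ hx.1 (hx.2.trans_le hρr))
      (hpos x hx)
  refine ⟨hcG, g, ⟨fun K hKU hK => memLp_restrict_of_continuousOn hK (hcG.mono hKU),
    fun K hKU hK => memLp_restrict_of_continuousOn hK (hcg.mono hKU),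
    isWeakGradient_of_hasFDerivAt hU hder hcg⟩, ?_⟩
  intro φ ψ hφ hφ0
  obtain ⟨K₀, hK₀U, hK₀, hφK⟩ := hφ.compactSupport
  have hψK := hφ.grad_eq_zero hU hK₀ hφK
  obtain ⟨χ, K', hχ, hK', hK'U, hχs, hχ1⟩ := exists_smooth_cutoff hU hK₀ hK₀U
  have : IsFiniteMeasure (volume.restrict U) := ⟨by simpa using hUb.lt_top⟩
  have hφi : Integrable φ (volume.restrict U) := hφ.memLp_fun.integrable (by norm_num)
  have hψi : Integrable ψ (volume.restrict U) := hφ.memLp_grad.integrable (by norm_num)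
  have hcV : ContinuousOn (fun x => μ / bdryDist Ω x ^ 2 * G (bdryDist Ω x)) U :=
    (continuousOn_const.div (hcδ.pow 2) fun x hx => (pow_pos (hpos x hx) 2).ne').mul hcG
  have hI1 : Integrable (fun x => inner ℝ (g x) (ψ x)) (volume.restrict U) := by
    obtain ⟨C, hC⟩ := hK₀.exists_bound_of_continuousOn (hcg.mono hK₀U)
    refine (hψi.norm.const_mul C).mono'
      ((hcg.aestronglyMeasurable hU.measurableSet).inner hψi.1) ?_
    filter_upwards [hψK] with x hx
    by_cases hxK : x ∈ K₀
    · exact (norm_inner_le_norm _ _).trans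
        (mul_le_mul_of_nonneg_right (hC x hxK) (norm_nonneg _))
    · simp [hx hxK]
  have hI2 : Integrable (fun x => μ / bdryDist Ω x ^ 2 * G (bdryDist Ω x) * φ x)
      (volume.restrict U) := by
    obtain ⟨C, hC⟩ := hK₀.exists_bound_of_continuousOn (hcV.mono hK₀U)
    refine (hφi.norm.const_mul C).mono'
      ((hcV.aestronglyMeasurable hU.measurableSet).mul hφi.1) ?_
    filter_upwards [hφK] with x hx
    by_cases hxK : x ∈ K₀
    · rw [norm_mul]
      exact mul_le_mul_of_nonneg_right (hC x hxK) (norm_nonneg _)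
    · simp [hx hxK]
  set M := (∫ x in U, φ x) + ∫ x in U, ‖ψ x‖ with hM
  have hM0 : 0 ≤ M := add_nonneg (integral_nonneg_of_ae hφ0)
    (integral_nonneg fun _ => norm_nonneg _)
  -- G∘δ is not assumed twice differentiable, so the inequality is proved for smooth approximations
  -- with an error τM, and τ → 0.
  suffices H : ∀ τ > 0, -(τ * M) ≤ (∫ x in U, inner ℝ (g x) (ψ x)) -
      ∫ x in U, μ / bdryDist Ω x ^ 2 * G (bdryDist Ω x) * φ x by
    by_contra! hneg
    have := H (-((∫ x in U, inner ℝ (g x) (ψ x)) -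
      ∫ x in U, μ / bdryDist Ω x ^ 2 * G (bdryDist Ω x) * φ x) / (2 * (M + 1)))
      (div_pos (by linarith) (by positivity))
    set I := (∫ x in U, inner ℝ (g x) (ψ x)) -
      ∫ x in U, μ / bdryDist Ω x ^ 2 * G (bdryDist Ω x) * φ x
    have h2 : -I / (2 * (M + 1)) * M ≤ -I / 2 := by
      rw [div_mul_eq_mul_div, div_le_div_iff₀ (by positivity) (by positivity)]
      nlinarith
    linarith
  intro τ hτ
  obtain ⟨D, hD, hDZ⟩ := exists_smooth_comp_bdryDist hreg hΩ hF hK'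
    (hK'U.trans fun x hx => ⟨hx.1, hx.2.trans_le hρr⟩) hG hτ
  have hwK : ∀ x ∈ K', ContDiffAt ℝ ∞ (G ∘ D) x := fun x hx =>
    (hG.contDiffAt (Ioi_mem_nhds (hDZ x hx).1)).comp x hD.contDiffAt
  obtain ⟨A, B, hA, hB, hAe, hBe, hAB⟩ :=
    hφ.green_identity hUb hφK hψK hχ hK' hK'U hχs hχ1 hwK
  have hK₀K' : K₀ ⊆ K' := fun x hx => hχs (subset_tsupport χ (by
    rw [Function.mem_support, (hχ1 x hx).self_of_nhds]; exact one_ne_zero))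
  have e1 : -(τ * ∫ x in U, ‖ψ x‖) ≤ (∫ x in U, inner ℝ (g x) (ψ x)) - ∫ x in U, B x := by
    rw [← integral_sub hI1 hB, ← integral_const_mul, ← integral_neg]
    refine integral_mono_ae (hψi.norm.const_mul τ).neg (hI1.sub hB) ?_
    filter_upwards [hBe, hψK] with x hx1 hx2
    rw [hx1]
    by_cases hxK : x ∈ K₀
    · rw [indicator_of_mem hxK]
      have h1 := (hDZ x (hK₀K' hxK)).2.2.1
      rw [← hinner, norm_sub_rev] at h1
      have h2 := (innerSL ℝ (g x) - fderiv ℝ (G ∘ D) x).le_opNorm (ψ x)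
      have h3 := (abs_le.1 (h2.trans (mul_le_mul_of_nonneg_right h1 (norm_nonneg _)))).1
      simpa using h3
    · simp [hx2 hxK, indicator_of_notMem hxK]
  have e2 : -(τ * ∫ x in U, φ x) ≤
      (∫ x in U, -A x) - ∫ x in U, μ / bdryDist Ω x ^ 2 * G (bdryDist Ω x) * φ x := by
    rw [← integral_sub hA.fun_neg hI2, ← integral_const_mul, ← integral_neg]
    refine integral_mono_ae (hφi.const_mul τ).neg (hA.fun_neg.sub hI2) ?_
    filter_upwards [hAe, hφK, hφ0] with x hx1 hx2 hx3
    rw [hx1]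
    by_cases hxK : x ∈ K₀
    · rw [indicator_of_mem hxK]
      have h1 := (abs_le.1 (hDZ x (hK₀K' hxK)).2.2.2).2
      have h2 := hsup (bdryDist Ω x) ⟨hpos x (hK₀U hxK), (hK₀U hxK).2⟩
      have h3 : lap (G ∘ D) x + μ / bdryDist Ω x ^ 2 * G (bdryDist Ω x) ≤ τ := by linarith
      have h4 := mul_le_mul_of_nonneg_right h3 hx3
      linarith
    · simp [hx2 hxK, indicator_of_notMem hxK]
  rw [integral_neg, hAB] at e2
  rw [hM, mul_add]
  linarith

end Existence

/-! ### From radial barriers to boundary bounds. -/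

section Barriers

variable {N : ℕ} {Ω : Set (EuclideanSpace ℝ (Fin N))}

local notation "𝔼" => EuclideanSpace ℝ (Fin N)

/-- `G` is a strict sub-solution on `(0, b]` of the radial equation with first order error `κ`. -/
structure IsRadialSub (κ μ b : ℝ) (G : ℝ → ℝ) : Prop where
  smooth : ContDiffOn ℝ ∞ G (Ioi 0)
  lt : ∀ t ∈ Ioc 0 b, κ * |deriv G t| < deriv (deriv G) t + μ / t ^ 2 * G t

/-- `G` is a super-solution on `(0, b]` of the radial equation with first order error `κ`. -/
structure IsRadialSuper (κ μ b : ℝ) (G : ℝ → ℝ) : Prop where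
  smooth : ContDiffOn ℝ ∞ G (Ioi 0)
  le : ∀ t ∈ Ioc 0 b, deriv (deriv G) t + κ * |deriv G t| + μ / t ^ 2 * G t ≤ 0

/-- Barriers for the radial equation on `(0, b]`, at the lower order `lo` and the upper order
`up`. -/
structure HasRadialBarriers (κ μ b : ℝ) (lo up : ℝ → ℝ) : Prop where
  lo_pos : ∀ t ∈ Ioc 0 b, 0 < lo t
  up_pos : ∀ t ∈ Ioc 0 b, 0 < up t
  exists_super_lo : ∃ G, IsRadialSuper κ μ b G ∧ Tendsto (fun t => G t / lo t) (𝓝[>] 0) (𝓝 1)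
  exists_super_up : ∃ G, IsRadialSuper κ μ b G ∧ Tendsto (fun t => G t / up t) (𝓝[>] 0) (𝓝 1)
  exists_sub_lo : ∃ G, IsRadialSub κ μ b G ∧ (∀ t ∈ Ioc 0 b, lo t ≤ G t) ∧
    Tendsto (fun t => G t / up t) (𝓝[>] 0) (𝓝 0)
  -- Being nonpositive at the outer end b', such a G satisfies the outer boundary condition of the
  -- comparison for every constant C ≥ 0.
  exists_sub_up : ∀ b' ∈ Ioc 0 b, ∃ G, IsRadialSub κ μ b' G ∧ G b' ≤ 0 ∧
    (∀ t ∈ Ioc 0 b', G t ≤ up t) ∧ ∀ᶠ t in 𝓝[>] 0, 0 < G t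

/-- The error κ|G'| is not linear, but it is subadditive and enters both inequalities with the
unfavourable sign, so strictness survives. -/
lemma IsRadialSub.sub_const_mul {κ μ b ε : ℝ} {G F : ℝ → ℝ} (hκ : 0 ≤ κ) (hG : IsRadialSub κ μ b G)
    (hF : IsRadialSuper κ μ b F) (hε : 0 < ε) : IsRadialSub κ μ b fun t => G t - ε * F t := by
  refine ⟨hG.smooth.sub (contDiffOn_const.mul hF.smooth), fun t ht => ?_⟩
  have hd : ∀ {H : ℝ → ℝ}, ContDiffOn ℝ ∞ H (Ioi 0) → ∀ s, 0 < s → HasDerivAt H (deriv H s) s :=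
    fun hH s hs => ((hH.contDiffAt (Ioi_mem_nhds hs)).differentiableAt (by simp)).hasDerivAt
  have h1 : ∀ s, 0 < s → deriv (fun t => G t - ε * F t) s = deriv G s - ε * deriv F s :=
    fun s hs => ((hd hG.smooth s hs).sub ((hd hF.smooth s hs).const_mul ε)).deriv
  have h2 : deriv (fun t => G t - ε * F t) =ᶠ[𝓝 t] fun s => deriv G s - ε * deriv F s := by
    filter_upwards [Ioi_mem_nhds ht.1] with s hs using h1 s hs
  have h3 : deriv (fun s => deriv G s - ε * deriv F s) t =
      deriv (deriv G) t - ε * deriv (deriv F) t :=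
    ((hd (contDiffOn_deriv_Ioi hG.smooth) t ht.1).sub
      ((hd (contDiffOn_deriv_Ioi hF.smooth) t ht.1).const_mul ε)).deriv
  rw [h2.deriv_eq, h1 t ht.1, h3]
  have h4 : |deriv G t - ε * deriv F t| ≤ |deriv G t| + ε * |deriv F t| := by
    refine (abs_sub _ _).trans ?_
    rw [abs_mul, abs_of_pos hε]
  have h5 := mul_le_mul_of_nonneg_left h4 hκ
  have h6 := mul_le_mul_of_nonneg_left (hF.le t ht) hε.le
  have h7 := hG.lt t ht
  linarith

lemma tendsto_bdryDist_toBdry (hΩ : IsOpen Ω) (hF : (frontier Ω).Nonempty) :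
    Tendsto (bdryDist Ω) (toBdry Ω) (𝓝[>] 0) := by
  refine tendsto_nhdsWithin_iff.2 ⟨tendsto_comap.mono_left inf_le_left, ?_⟩
  filter_upwards [mem_inf_of_right (mem_principal_self Ω)] with x hx using bdryDist_pos hΩ hF hx

lemma eventually_mem_toBdry : ∀ᶠ x in toBdry Ω, x ∈ Ω := mem_inf_of_right (mem_principal_self Ω)

lemma exists_forall_of_eventually_toBdry {p : 𝔼 → Prop} (h : ∀ᶠ x in toBdry Ω, p x) :
    ∃ η > 0, ∀ x ∈ Ω, bdryDist Ω x < η → p x := by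
  rw [toBdry, eventually_inf_principal, eventually_comap] at h
  obtain ⟨η, hη, h2⟩ := Metric.eventually_nhds_iff.1 h
  refine ⟨η, hη, fun x hx hxη => h2 ?_ x rfl hx⟩
  rwa [Real.dist_eq, sub_zero, abs_of_nonneg (bdryDist_nonneg x)]

lemma exists_mem_bdryDist_lt (hF : (frontier Ω).Nonempty) {η : ℝ} (hη : 0 < η) :
    ∃ x ∈ Ω, bdryDist Ω x < η := by
  obtain ⟨y, hy⟩ := hF
  obtain ⟨x, hx, hxy⟩ := Metric.mem_closure_iff.1 (frontier_subset_closure hy) η hη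
  refine ⟨x, hx, (Metric.infDist_le_dist_of_mem hy).trans_lt ?_⟩
  rwa [dist_comm]

lemma exists_Ioc_of_eventually {p : ℝ → Prop} (h : ∀ᶠ t in 𝓝[>] (0 : ℝ), p t) :
    ∃ η > 0, ∀ t ∈ Ioc 0 η, p t := by
  obtain ⟨η, hη, h2⟩ := (mem_nhdsGT_iff_exists_Ioc_subset).1 h
  exact ⟨η, hη, fun t ht => h2 ht⟩

variable {μ r K b₀ : ℝ} {e : EuclideanSpace ℝ (Fin N) → EuclideanSpace ℝ (Fin N)} {lo up : ℝ → ℝ}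

/-- Compare u with G - εF, where G is a sub-solution above `lo` and F a super-solution of order
`up`. As G/up → 0 and F/up → 1, the difference is negative at a small level a; letting ε → 0 removes
F. -/
lemma IsPosLocalSuperHarmonic.exists_lo_le (hΩ : IsOpen Ω) (hb : Bornology.IsBounded Ω)
    (hF : (frontier Ω).Nonempty) (hr : 0 < r) (hreg : BdryDistRegular Ω r K e) (hb₀ : 0 < b₀)
    (H : HasRadialBarriers (N * (6 * K)) μ b₀ lo up) {u : EuclideanSpace ℝ (Fin N) → ℝ}
    (hu : IsPosLocalSuperHarmonic Ω μ u) :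
    ∃ C > 0, ∃ b > 0, ∀ x ∈ Ω, bdryDist Ω x ≤ b → lo (bdryDist Ω x) ≤ C * u x := by
  obtain ⟨ρ, hρ, hsh, hpos⟩ := hu
  have hK := hreg.pos
  obtain ⟨F, hFs, hFl⟩ := H.exists_super_up
  obtain ⟨G, hGs, hGlo, hGl⟩ := H.exists_sub_lo
  obtain ⟨b₁, hb₁, hFpos⟩ := exists_Ioc_of_eventually (hFl.eventually (lt_mem_nhds one_pos))
  set b := min (min b₀ b₁) (min (ρ / 2) (r / 2)) with hbdef
  have hb0 : 0 < b := by positivity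
  have hbb₀ : b ≤ b₀ := (min_le_left _ _).trans (min_le_left _ _)
  have hbb₁ : b ≤ b₁ := (min_le_left _ _).trans (min_le_right _ _)
  have hbρ : b < ρ := ((min_le_right _ _).trans (min_le_left _ _)).trans_lt (by linarith)
  have hbr : b < r := ((min_le_right _ _).trans (min_le_right _ _)).trans_lt (by linarith)
  have hFp : ∀ t ∈ Ioc 0 b, 0 < F t := fun t ht =>
    (div_pos_iff_of_pos_right (H.up_pos t ⟨ht.1, ht.2.trans hbb₀⟩)).1
      (hFpos t ⟨ht.1, ht.2.trans hbb₁⟩)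
  have hZ := isCompact_bdryDist_preimage_Icc hΩ hb (b := b) hb0
  have hZρ : {x ∈ Ω | bdryDist Ω x ∈ Icc b b} ⊆ bdryStrip Ω ρ := fun x hx =>
    ⟨hx.1, hx.2.2.trans_lt hbρ⟩
  obtain ⟨m, hm, hmZ⟩ := hZ.exists_forall_le' (hsh.1.mono hZρ) fun x hx => hpos x (hZρ hx)
  -- This constant comes from the outer level only and does not depend on ε, as the limit ε → 0
  -- requires.
  set C := |G b| / m + 1 with hC
  have hC0 : 0 < C := by positivity
  have hCb : ∀ x ∈ Ω, bdryDist Ω x = b → G b ≤ C * u x := fun x hx hxb => by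
    have h1 : m ≤ u x := hmZ x ⟨hx, hxb.ge, hxb.le⟩
    calc G b ≤ |G b| := le_abs_self _
      _ = |G b| / m * m := by field_simp
      _ ≤ C * m := by gcongr; linarith
      _ ≤ C * u x := by gcongr
  refine ⟨C, hC0, b, hb0, fun x hx hxb => ?_⟩
  have hxpos := bdryDist_pos hΩ hF hx
  refine (hGlo _ ⟨hxpos, hxb.trans hbb₀⟩).trans ?_
  have main : ∀ ε > 0, G (bdryDist Ω x) - ε * F (bdryDist Ω x) ≤ C * u x := by
    intro ε hε
    have hlim : Tendsto (fun t => G t / up t - ε * (F t / up t)) (𝓝[>] 0) (𝓝 (0 - ε * 1)) :=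
      hGl.sub (hFl.const_mul ε)
    obtain ⟨η, hη, hη2⟩ := exists_Ioc_of_eventually
      (hlim.eventually (gt_mem_nhds (show 0 - ε * 1 < 0 by linarith)))
    set a := min η (bdryDist Ω x) with ha
    have ha0 : 0 < a := lt_min hη hxpos
    have hab : a ≤ b := (min_le_right _ _).trans hxb
    refine hsh.comparison hΩ hb hF hreg hpos (a := a) (b := b) (C := C)
      (G := fun t => G t - ε * F t) ha0 hbρ hbr hC0.le
      (hGs.sub_const_mul (by positivity) hFs hε).smooth (fun t ht => ?_) ?_ x hx
      ⟨min_le_right _ _, hxb⟩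
    · exact (hGs.sub_const_mul (by positivity) hFs hε).lt t
        ⟨ha0.trans_le ht.1, ht.2.trans hbb₀⟩
    · rintro y hy (hya | hyb)
      · have hyρ : y ∈ bdryStrip Ω ρ := ⟨hy, by rw [hya]; exact hab.trans_lt hbρ⟩
        have h1 := hη2 a ⟨ha0, min_le_left _ _⟩
        have h2 := H.up_pos a ⟨ha0, hab.trans hbb₀⟩
        have h3 : (G a - ε * F a) / up a < 0 := by rw [sub_div, mul_div_assoc]; exact h1
        rw [div_lt_iff₀ h2, zero_mul] at h3
        rw [hya]
        exact h3.le.trans (mul_nonneg hC0.le (hpos y hyρ).le)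
      · have h1 := hCb y hy hyb
        have h2 := mul_pos hε (hFp b ⟨hb0, le_rfl⟩)
        simp only [hyb]
        linarith
  have hFx := hFp _ ⟨hxpos, hxb⟩
  refine le_of_forall_pos_le_add fun η hη => ?_
  have h1 := main (η / F (bdryDist Ω x)) (div_pos hη hFx)
  rw [div_mul_cancel₀ _ hFx.ne'] at h1
  linarith

lemma IsPosLocalSuperHarmonic.liminf_lo_pos (hΩ : IsOpen Ω) (hb : Bornology.IsBounded Ω)
    (hF : (frontier Ω).Nonempty) (hr : 0 < r) (hreg : BdryDistRegular Ω r K e) (hb₀ : 0 < b₀)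
    (H : HasRadialBarriers (N * (6 * K)) μ b₀ lo up) {u : EuclideanSpace ℝ (Fin N) → ℝ}
    (hu : IsPosLocalSuperHarmonic Ω μ u) :
    0 < bdryLiminf Ω u fun x => lo (bdryDist Ω x) := by
  obtain ⟨C, hC, b, hb', h⟩ := hu.exists_lo_le hΩ hb hF hr hreg hb₀ H
  have h0 : (0 : EReal) < ((C⁻¹ : ℝ) : EReal) := by exact_mod_cast inv_pos.2 hC
  refine h0.trans_le (le_liminf_of_le (by isBoundedDefault) ?_)
  filter_upwards [eventually_mem_toBdry, (tendsto_bdryDist_toBdry hΩ hF).eventually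
    (Ioc_mem_nhdsGT (lt_min hb' hb₀))] with x hx hxb
  have h1 := H.lo_pos _ ⟨hxb.1, hxb.2.trans (min_le_right _ _)⟩
  rw [EReal.coe_le_coe_iff, le_div_iff₀ h1, inv_mul_le_iff₀ hC]
  exact h x hx (hxb.2.trans (min_le_left _ _))

/-- An infinite liminf gives `up` ≤ C u close to ∂Ω for every C > 0. Comparison then yields G ≤ C u
at a point x fixed beforehand, which fails for small C because G(δ(x)) > 0. -/
lemma IsPosLocalSuperHarmonic.liminf_up_lt_top (hΩ : IsOpen Ω) (hb : Bornology.IsBounded Ω)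
    (hF : (frontier Ω).Nonempty) (hr : 0 < r) (hreg : BdryDistRegular Ω r K e) (hb₀ : 0 < b₀)
    (H : HasRadialBarriers (N * (6 * K)) μ b₀ lo up) {u : EuclideanSpace ℝ (Fin N) → ℝ}
    (hu : IsPosLocalSuperHarmonic Ω μ u) :
    (bdryLiminf Ω u fun x => up (bdryDist Ω x)) < ⊤ := by
  obtain ⟨ρ, hρ, hsh, hpos⟩ := hu
  by_contra hcon
  rw [not_lt_top_iff] at hcon
  set b := min b₀ (min (ρ / 2) (r / 2)) with hbdef
  have hb0 : 0 < b := by positivity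
  have hbb₀ : b ≤ b₀ := min_le_left _ _
  have hbρ : b < ρ := ((min_le_right _ _).trans (min_le_left _ _)).trans_lt (by linarith)
  have hbr : b < r := ((min_le_right _ _).trans (min_le_right _ _)).trans_lt (by linarith)
  obtain ⟨G, hGs, hGb, hGup, hGpos⟩ := H.exists_sub_up b ⟨hb0, hbb₀⟩
  obtain ⟨η, hη, hηG⟩ := exists_Ioc_of_eventually hGpos
  obtain ⟨x, hx, hxη⟩ := exists_mem_bdryDist_lt hF (lt_min hη hb0)
  have hxpos := bdryDist_pos hΩ hF hx
  have hxb : bdryDist Ω x ≤ b := hxη.le.trans (min_le_right _ _)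
  have hGx : 0 < G (bdryDist Ω x) := hηG _ ⟨hxpos, hxη.le.trans (min_le_left _ _)⟩
  have hux : 0 < u x := hpos x ⟨hx, hxb.trans_lt hbρ⟩
  have main : ∀ C > 0, G (bdryDist Ω x) ≤ C * u x := by
    intro C hC
    have h1 : ∀ᶠ y in toBdry Ω, ((C⁻¹ : ℝ) : EReal) < ((u y / up (bdryDist Ω y) : ℝ) : EReal) := by
      refine eventually_lt_of_lt_liminf (lt_of_lt_of_eq (EReal.coe_lt_top _) hcon.symm) ?_
      isBoundedDefault
    obtain ⟨ζ, hζ, hζ2⟩ := exists_forall_of_eventually_toBdry h1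
    set a := min (ζ / 2) (bdryDist Ω x) with ha
    have ha0 : 0 < a := lt_min (half_pos hζ) hxpos
    have hab : a ≤ b := (min_le_right _ _).trans hxb
    refine hsh.comparison hΩ hb hF hreg hpos (a := a) (b := b) (C := C) (G := G) ha0 hbρ hbr hC.le
      hGs.smooth (fun t ht => hGs.lt t ⟨ha0.trans_le ht.1, ht.2⟩) ?_ x hx
      ⟨min_le_right _ _, hxb⟩
    rintro y hy (hya | hyb)
    · have h2 := hζ2 y hy (by
        rw [hya]; exact (min_le_left _ _).trans_lt (half_lt_self hζ))
      have h3 : 0 < up (bdryDist Ω y) := H.up_pos _ (by rw [hya]; exact ⟨ha0, hab.trans hbb₀⟩)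
      rw [EReal.coe_lt_coe_iff, lt_div_iff₀ h3, inv_mul_lt_iff₀ hC] at h2
      exact (hGup _ (by rw [hya]; exact ⟨ha0, hab⟩)).trans h2.le
    · have hyρ : y ∈ bdryStrip Ω ρ := ⟨hy, by rw [hyb]; exact hbρ⟩
      rw [hyb]
      exact hGb.trans (mul_nonneg hC.le (hpos y hyρ).le)
  have h1 := main (G (bdryDist Ω x) / (2 * u x)) (by positivity)
  have h2 : G (bdryDist Ω x) / (2 * u x) * u x = G (bdryDist Ω x) / 2 := by field_simp
  linarith

lemma exists_isPosLocalSuperHarmonic_of_radialSuper (hΩ : IsOpen Ω) (hb : Bornology.IsBounded Ω)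
    (hF : (frontier Ω).Nonempty) (hr : 0 < r) (hreg : BdryDistRegular Ω r K e) (hb₀ : 0 < b₀)
    {w G : ℝ → ℝ} (hw : ∀ t ∈ Ioc 0 b₀, 0 < w t) (hG : IsRadialSuper (N * (6 * K)) μ b₀ G)
    (hlim : Tendsto (fun t => G t / w t) (𝓝[>] 0) (𝓝 1)) :
    ∃ h : EuclideanSpace ℝ (Fin N) → ℝ, IsPosLocalSuperHarmonic Ω μ h ∧
      Tendsto (fun x => h x / w (bdryDist Ω x)) (toBdry Ω) (𝓝 1) := by
  obtain ⟨b₁, hb₁, hpos⟩ := exists_Ioc_of_eventually (hlim.eventually (lt_mem_nhds one_pos))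
  set ρ := min (min b₀ b₁) r with hρdef
  have h0 : ρ ≤ b₀ := (min_le_left _ _).trans (min_le_left _ _)
  have h1 : ρ ≤ b₁ := (min_le_left _ _).trans (min_le_right _ _)
  refine ⟨fun x => G (bdryDist Ω x), ⟨ρ, by positivity, isSuperHarmonic_comp_bdryDist hΩ hb hF hreg
    (min_le_right _ _) hG.smooth fun t ht => hG.le t ⟨ht.1, ht.2.le.trans h0⟩, fun x hx => ?_⟩,
    hlim.comp (tendsto_bdryDist_toBdry hΩ hF)⟩
  have hxp := bdryDist_pos hΩ hF hx.1
  exact (div_pos_iff_of_pos_right (hw _ ⟨hxp, hx.2.le.trans h0⟩)).1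
    (hpos _ ⟨hxp, hx.2.le.trans h1⟩)

/-- Radial barriers at the orders `lo` and `up` give sharp boundary bounds for positive local
super-harmonics. -/
theorem hasSharpSuperHarmonicBounds_of_radialBarriers (hΩ : IsOpen Ω)
    (hb : Bornology.IsBounded Ω) (hF : (frontier Ω).Nonempty) (hk : HasCkBoundary 2 Ω)
    (H : ∀ κ, 0 ≤ κ → ∃ b₀ > 0, HasRadialBarriers κ μ b₀ lo up) :
    HasSharpSuperHarmonicBounds Ω μ (fun x => lo (bdryDist Ω x)) fun x => up (bdryDist Ω x) := by
  obtain ⟨r, hr, K, hK, e, he⟩ := exists_bdryDist_quadratic_bound hΩ hb hF hk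
  have hreg : BdryDistRegular Ω r K e :=
    ⟨hK, fun x hx hxr => (he x hx hxr).1, fun x hx hxr => (he x hx hxr).2⟩
  obtain ⟨b₀, hb₀, H⟩ := H (N * (6 * K)) (by positivity)
  refine ⟨fun u hu => ⟨hu.liminf_lo_pos hΩ hb hF hr hreg hb₀ H,
    hu.liminf_up_lt_top hΩ hb hF hr hreg hb₀ H⟩, ?_, ?_⟩
  · obtain ⟨G, hG, hlim⟩ := H.exists_super_lo
    exact exists_isPosLocalSuperHarmonic_of_radialSuper hΩ hb hF hr hreg hb₀ H.lo_pos hG hlim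
  · obtain ⟨G, hG, hlim⟩ := H.exists_super_up
    exact exists_isPosLocalSuperHarmonic_of_radialSuper hΩ hb hF hr hreg hb₀ H.up_pos hG hlim

end Barriers

/-! ### The radial operator on explicit functions. -/

section Calculus

lemma deriv_eq_and_deriv_deriv_eq {G G₁ G₂ : ℝ → ℝ} (h1 : ∀ t, 0 < t → HasDerivAt G (G₁ t) t)
    (h2 : ∀ t, 0 < t → HasDerivAt G₁ (G₂ t) t) {t : ℝ} (ht : 0 < t) :
    deriv G t = G₁ t ∧ deriv (deriv G) t = G₂ t := by
  refine ⟨(h1 t ht).deriv, ?_⟩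
  have : deriv G =ᶠ[𝓝 t] G₁ := by
    filter_upwards [Ioi_mem_nhds ht] with s hs using (h1 s hs).deriv
  rw [this.deriv_eq, (h2 t ht).deriv]

lemma contDiffOn_rpow_Ioi (p : ℝ) : ContDiffOn ℝ ∞ (fun t : ℝ => t ^ p) (Ioi 0) := fun _ ht =>
  (Real.contDiffAt_rpow_const_of_ne (ne_of_gt ht)).contDiffWithinAt

lemma exists_rpow_lt {C c a : ℝ} (hc : 0 < c) (ha : 0 < a) :
    ∃ b > 0, b ≤ 1 ∧ ∀ t ∈ Ioc 0 b, C * t ^ a < c := by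
  have h1 : Tendsto (fun t : ℝ => C * t ^ a) (𝓝[>] 0) (𝓝 0) := by
    have := (((Real.continuousAt_rpow_const 0 a (Or.inr ha.le)).tendsto).const_mul C)
    rw [Real.zero_rpow ha.ne', mul_zero] at this
    exact this.mono_left nhdsWithin_le_nhds
  obtain ⟨b, hb, h⟩ := exists_Ioc_of_eventually (h1.eventually (gt_mem_nhds hc))
  exact ⟨min b 1, lt_min hb one_pos, min_le_right _ _, fun t ht =>
    h t ⟨ht.1, ht.2.trans (min_le_left _ _)⟩⟩

lemma tendsto_rpow_zero {a : ℝ} (ha : 0 < a) :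
    Tendsto (fun t : ℝ => t ^ a) (𝓝[>] 0) (𝓝 0) := by
  have := (Real.continuousAt_rpow_const 0 a (Or.inr ha.le)).tendsto
  rw [Real.zero_rpow ha.ne'] at this
  exact this.mono_left nhdsWithin_le_nhds

/-- The radial operator on `t ^ p + β t ^ q`, where `p` is a characteristic exponent. -/
lemma twoPow_estimates {μ p q β t : ℝ} (hp : p * (p - 1) + μ = 0) (hβ : 1 ≤ |β|)
    (hqp : q ≤ p + 1 / 2) (ht : 0 < t) (ht1 : t ≤ 1) :
    |deriv (fun s : ℝ => s ^ p + β * s ^ q) t| ≤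
        |β| * t ^ (q - 2) * ((|p| + |q|) * t ^ (1 / 2 : ℝ)) ∧
      deriv (deriv fun s : ℝ => s ^ p + β * s ^ q) t + μ / t ^ 2 * (t ^ p + β * t ^ q) =
        β * t ^ (q - 2) * (q * (q - 1) + μ) := by
  obtain ⟨h1, h2⟩ := deriv_eq_and_deriv_deriv_eq (G := fun s : ℝ => s ^ p + β * s ^ q)
    (G₁ := fun s => p * s ^ (p - 1) + β * (q * s ^ (q - 1)))
    (G₂ := fun s => p * ((p - 1) * s ^ (p - 1 - 1)) + β * (q * ((q - 1) * s ^ (q - 1 - 1))))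
    (fun s hs => (Real.hasDerivAt_rpow_const (Or.inl hs.ne')).add
      ((Real.hasDerivAt_rpow_const (Or.inl hs.ne')).const_mul β))
    (fun s hs => ((Real.hasDerivAt_rpow_const (Or.inl hs.ne')).const_mul p).add
      (((Real.hasDerivAt_rpow_const (Or.inl hs.ne')).const_mul q).const_mul β)) ht
  rw [h1, h2]
  constructor
  -- Since q ≤ p + 1/2, both p - 1 and q - 1 exceed q - 2 by at least 1/2; this is the gain of
  -- t^(1/2) over the main term.
  · have e1 : t ^ (p - 1) = t ^ (q - 2) * t ^ (p + 1 - q) := by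
      rw [← Real.rpow_add ht]; congr 1; ring
    have e2 : t ^ (q - 1) = t ^ (q - 2) * t ^ (1 : ℝ) := by
      rw [← Real.rpow_add ht]; congr 1; ring
    have e3 : t ^ (p + 1 - q) ≤ t ^ (1 / 2 : ℝ) :=
      Real.rpow_le_rpow_of_exponent_ge ht ht1 (by linarith)
    have e4 : t ^ (1 : ℝ) ≤ t ^ (1 / 2 : ℝ) :=
      Real.rpow_le_rpow_of_exponent_ge ht ht1 (by norm_num)
    have hT : 0 < t ^ (q - 2) := Real.rpow_pos_of_pos ht _
    have hS : 0 < t ^ (1 / 2 : ℝ) := Real.rpow_pos_of_pos ht _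
    refine (abs_add_le _ _).trans ?_
    simp only [abs_mul, abs_of_pos (Real.rpow_pos_of_pos ht _)]
    have f1 : |p| * t ^ (p - 1) ≤ |β| * (|p| * (t ^ (q - 2) * t ^ (1 / 2 : ℝ))) := by
      calc |p| * t ^ (p - 1) ≤ |p| * (t ^ (q - 2) * t ^ (1 / 2 : ℝ)) := by
            rw [e1]; gcongr
        _ ≤ _ := le_mul_of_one_le_left (by positivity) hβ
    have f2 : |β| * (|q| * t ^ (q - 1)) ≤ |β| * (|q| * (t ^ (q - 2) * t ^ (1 / 2 : ℝ))) := by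
      rw [e2]; gcongr
    linarith
  · have e1 : t ^ p = t ^ (p - 2) * t ^ 2 := by
      rw [← Real.rpow_natCast t 2, ← Real.rpow_add ht]; congr 1; norm_num
    have e2 : t ^ q = t ^ (q - 2) * t ^ 2 := by
      rw [← Real.rpow_natCast t 2, ← Real.rpow_add ht]; congr 1; norm_num
    rw [e1, e2, show p - 1 - 1 = p - 2 by ring, show q - 1 - 1 = q - 2 by ring]
    field_simp
    linear_combination t ^ (p - 2) * hp

lemma contDiffOn_twoPow (p q β : ℝ) :
    ContDiffOn ℝ ∞ (fun t : ℝ => t ^ p + β * t ^ q) (Ioi 0) :=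
  (contDiffOn_rpow_Ioi p).add (contDiffOn_const.mul (contDiffOn_rpow_Ioi q))

/-- The Euler operator kills t^p, so the sign is that of β(q(q - 1) + μ), and `hsmall` says that the
first-order error stays below this term. -/
lemma isRadialSub_twoPow {κ μ p q β b : ℝ} (hκ : 0 ≤ κ) (hp : p * (p - 1) + μ = 0)
    (hβ : 1 ≤ |β|) (hqp : q ≤ p + 1 / 2) (hb : b ≤ 1)
    (hsign : 0 < β * (q * (q - 1) + μ))
    (hsmall : ∀ t ∈ Ioc 0 b, κ * (|p| + |q|) * t ^ (1 / 2 : ℝ) < |q * (q - 1) + μ|) :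
    IsRadialSub κ μ b fun t => t ^ p + β * t ^ q := by
  refine ⟨contDiffOn_twoPow p q β, fun t ht => ?_⟩
  obtain ⟨h1, h2⟩ := twoPow_estimates hp hβ hqp ht.1 (ht.2.trans hb)
  rw [h2]
  have hT : 0 < t ^ (q - 2) := Real.rpow_pos_of_pos ht.1 _
  have h3 : β * t ^ (q - 2) * (q * (q - 1) + μ) = |β| * t ^ (q - 2) * |q * (q - 1) + μ| := by
    rw [mul_right_comm, mul_right_comm |β|, ← abs_mul, abs_of_pos hsign]
  rw [h3]
  have h4 := mul_lt_mul_of_pos_left (hsmall t ht)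
    (show 0 < |β| * t ^ (q - 2) by positivity)
  have h5 := mul_le_mul_of_nonneg_left h1 hκ
  linarith

lemma isRadialSuper_twoPow {κ μ p q β b : ℝ} (hκ : 0 ≤ κ) (hp : p * (p - 1) + μ = 0)
    (hβ : 1 ≤ |β|) (hqp : q ≤ p + 1 / 2) (hb : b ≤ 1)
    (hsign : β * (q * (q - 1) + μ) < 0)
    (hsmall : ∀ t ∈ Ioc 0 b, κ * (|p| + |q|) * t ^ (1 / 2 : ℝ) < |q * (q - 1) + μ|) :
    IsRadialSuper κ μ b fun t => t ^ p + β * t ^ q := by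
  refine ⟨contDiffOn_twoPow p q β, fun t ht => ?_⟩
  obtain ⟨h1, h2⟩ := twoPow_estimates hp hβ hqp ht.1 (ht.2.trans hb)
  have hT : 0 < t ^ (q - 2) := Real.rpow_pos_of_pos ht.1 _
  have h3 : β * t ^ (q - 2) * (q * (q - 1) + μ) = -(|β| * t ^ (q - 2) * |q * (q - 1) + μ|) := by
    rw [mul_right_comm, mul_right_comm |β|, ← abs_mul, abs_of_neg hsign]; ring
  have h4 := mul_lt_mul_of_pos_left (hsmall t ht)
    (show 0 < |β| * t ^ (q - 2) by positivity)
  have h5 := mul_le_mul_of_nonneg_left h1 hκ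
  linarith

lemma twoPow_div_tendsto_one {p q β : ℝ} (hpq : p < q) :
    Tendsto (fun t : ℝ => (t ^ p + β * t ^ q) / t ^ p) (𝓝[>] 0) (𝓝 1) := by
  have h1 : Tendsto (fun t : ℝ => 1 + β * t ^ (q - p)) (𝓝[>] 0) (𝓝 (1 + β * 0)) :=
    tendsto_const_nhds.add ((tendsto_rpow_zero (sub_pos.2 hpq)).const_mul β)
  rw [mul_zero, add_zero] at h1
  refine h1.congr' ?_
  filter_upwards [self_mem_nhdsWithin] with t ht
  have ht0 : 0 < t := ht
  have := Real.rpow_pos_of_pos ht0 p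
  rw [Real.rpow_sub ht0]
  field_simp

/-- The radial operator with `μ = 1/4` on `t ^ (1/2) (B - log t) + A t`. -/
lemma sqrtLog_estimates {A B t : ℝ} (hA : |A| = 1) (hB : |B - Real.log t| ≤ |Real.log t| + 1)
    (ht : 0 < t) (ht1 : t ≤ 1) :
    |deriv (fun s : ℝ => s ^ (1 / 2 : ℝ) * (B - Real.log s) + A * s) t| ≤
        t⁻¹ * (5 * t ^ (1 / 4 : ℝ)) ∧
      deriv (deriv fun s : ℝ => s ^ (1 / 2 : ℝ) * (B - Real.log s) + A * s) t
        + 1 / 4 / t ^ 2 * (t ^ (1 / 2 : ℝ) * (B - Real.log t) + A * t) = A * t⁻¹ * (1 / 4) := by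
  obtain ⟨h1, h2⟩ := deriv_eq_and_deriv_deriv_eq
    (G := fun s : ℝ => s ^ (1 / 2 : ℝ) * (B - Real.log s) + A * s)
    (G₁ := fun s => ((1 / 2) * s ^ ((1 / 2 : ℝ) - 1) * (B - Real.log s)
      + s ^ (1 / 2 : ℝ) * (-s⁻¹)) + A * 1)
    (G₂ := fun s => ((1 / 2) * (((1 / 2 : ℝ) - 1) * s ^ ((1 / 2 : ℝ) - 1 - 1)) * (B - Real.log s)
      + (1 / 2) * s ^ ((1 / 2 : ℝ) - 1) * (-s⁻¹))
      + ((1 / 2) * s ^ ((1 / 2 : ℝ) - 1) * (-s⁻¹) + s ^ (1 / 2 : ℝ) * (-(-(s ^ 2)⁻¹))))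
    (fun s hs => ((Real.hasDerivAt_rpow_const (Or.inl hs.ne')).mul
      ((Real.hasDerivAt_log hs.ne').const_sub B)).add ((hasDerivAt_id s).const_mul A))
    (fun s hs => ((((Real.hasDerivAt_rpow_const (Or.inl hs.ne')).const_mul (1 / 2)).mul
      ((Real.hasDerivAt_log hs.ne').const_sub B)).add
      ((Real.hasDerivAt_rpow_const (Or.inl hs.ne')).mul (hasDerivAt_inv hs.ne').neg)).add_const _)
    ht
  rw [h1, h2]
  have e1 : t ^ ((1 / 2 : ℝ) - 1) = t ^ (1 / 2 : ℝ) * t⁻¹ := by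
    rw [Real.rpow_sub ht, Real.rpow_one, div_eq_mul_inv]
  have e2 : t ^ ((1 / 2 : ℝ) - 1 - 1) = t ^ (1 / 2 : ℝ) * t⁻¹ * t⁻¹ := by
    rw [Real.rpow_sub ht, Real.rpow_one, e1, div_eq_mul_inv]
  rw [e1, e2]
  have hS : 0 < t ^ (1 / 2 : ℝ) := Real.rpow_pos_of_pos ht _
  have hQ : 0 < t ^ (1 / 4 : ℝ) := Real.rpow_pos_of_pos ht _
  constructor
  -- Half of the factor t^(1/2) is spent on the logarithm, via |log t| t^(1/4) ≤ 4; the other half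
  -- remains as t^(1/4).
  · have hlog := (Real.abs_log_mul_self_rpow_lt t (1 / 4) ht ht1 (by norm_num)).le
    rw [abs_mul, abs_of_pos hQ] at hlog
    have e3 : t ^ (1 / 2 : ℝ) = t ^ (1 / 4 : ℝ) * t ^ (1 / 4 : ℝ) := by
      rw [← Real.rpow_add ht]; norm_num
    have e4 : t ^ (1 / 4 : ℝ) ≤ 1 := Real.rpow_le_one ht.le ht1 (by norm_num)
    have e5 : t ≤ t ^ (1 / 4 : ℝ) := by
      calc t = t ^ (1 : ℝ) := (Real.rpow_one t).symm
        _ ≤ _ := Real.rpow_le_rpow_of_exponent_ge ht ht1 (by norm_num)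
    have e6 : |1 / 2 * (t ^ (1 / 2 : ℝ) * t⁻¹) * (B - Real.log t) + t ^ (1 / 2 : ℝ) * -t⁻¹ + A * 1|
        = t⁻¹ * |1 / 2 * t ^ (1 / 2 : ℝ) * (B - Real.log t) - t ^ (1 / 2 : ℝ) + A * t| := by
      rw [← abs_of_pos (inv_pos.2 ht), ← abs_mul, abs_of_pos (inv_pos.2 ht)]
      congr 1; field_simp; ring
    rw [e6]
    refine mul_le_mul_of_nonneg_left ?_ (inv_pos.2 ht).le
    have g1 : |1 / 2 * t ^ (1 / 2 : ℝ) * (B - Real.log t)| ≤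
        1 / 2 * t ^ (1 / 2 : ℝ) * (|Real.log t| + 1) := by
      rw [abs_mul, abs_of_pos (by positivity : (0 : ℝ) < 1 / 2 * t ^ (1 / 2 : ℝ))]
      gcongr
    have g2 : |A * t| = t := by rw [abs_mul, hA, one_mul, abs_of_pos ht]
    have g3 := abs_add_le (1 / 2 * t ^ (1 / 2 : ℝ) * (B - Real.log t) - t ^ (1 / 2 : ℝ)) (A * t)
    have g4 := abs_sub (1 / 2 * t ^ (1 / 2 : ℝ) * (B - Real.log t)) (t ^ (1 / 2 : ℝ))
    rw [abs_of_pos hS] at g4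
    have g5 : t ^ (1 / 2 : ℝ) * |Real.log t| ≤ t ^ (1 / 4 : ℝ) * 4 := by
      rw [e3]
      have : |Real.log t| * t ^ (1 / 4 : ℝ) ≤ 4 := hlog.trans (by norm_num)
      nlinarith
    have g6 : t ^ (1 / 2 : ℝ) ≤ t ^ (1 / 4 : ℝ) := by rw [e3]; nlinarith
    linarith
  · field_simp
    ring

lemma contDiffOn_sqrtLog (A B : ℝ) :
    ContDiffOn ℝ ∞ (fun s : ℝ => s ^ (1 / 2 : ℝ) * (B - Real.log s) + A * s) (Ioi 0) :=
  ((contDiffOn_rpow_Ioi _).mul (contDiffOn_const.sub (contDiffOn_id.log fun _ ht =>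
    (ne_of_gt ht)))).add (contDiffOn_const.mul contDiffOn_id)

end Calculus

/-! ### Barriers in the subcritical and critical cases. -/

section RadialBarriers

/-- At μ = 1/4 the operator kills t^(1/2)(B - log t); the added term t contributes 1/(4t), which
beats the first-order error. -/
lemma isRadialSub_sqrtLog {κ B b : ℝ} (hκ : 0 ≤ κ) (hb : b ≤ 1)
    (hB : ∀ t ∈ Ioc 0 b, |B - Real.log t| ≤ |Real.log t| + 1)
    (hsmall : ∀ t ∈ Ioc 0 b, 5 * κ * t ^ (1 / 4 : ℝ) < 1 / 4) :
    IsRadialSub κ (1 / 4) b fun s => s ^ (1 / 2 : ℝ) * (B - Real.log s) + 1 * s := by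
  refine ⟨contDiffOn_sqrtLog 1 B, fun t ht => ?_⟩
  obtain ⟨h1, h2⟩ := sqrtLog_estimates (A := 1) (by simp) (hB t ht) ht.1 (ht.2.trans hb)
  rw [h2]
  have h3 := mul_le_mul_of_nonneg_left h1 hκ
  have h4 := mul_lt_mul_of_pos_left (hsmall t ht) (inv_pos.2 ht.1)
  linarith

lemma isRadialSuper_sqrtLog {κ b : ℝ} (hκ : 0 ≤ κ) (hb : b ≤ 1)
    (hsmall : ∀ t ∈ Ioc 0 b, 5 * κ * t ^ (1 / 4 : ℝ) < 1 / 4) :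
    IsRadialSuper κ (1 / 4) b fun s => s ^ (1 / 2 : ℝ) * (0 - Real.log s) + (-1) * s := by
  refine ⟨contDiffOn_sqrtLog (-1) 0, fun t ht => ?_⟩
  obtain ⟨h1, h2⟩ := sqrtLog_estimates (A := -1) (B := 0) (by simp) (by simp) ht.1 (ht.2.trans hb)
  have h3 := mul_le_mul_of_nonneg_left h1 hκ
  have h4 := mul_lt_mul_of_pos_left (hsmall t ht) (inv_pos.2 ht.1)
  linarith

lemma betaPlus_eq {μ : ℝ} (hμ : μ ≤ 1 / 4) : betaPlus μ * (betaPlus μ - 1) + μ = 0 := by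
  have := Real.sq_sqrt (sub_nonneg.2 hμ)
  rw [betaPlus]; linear_combination this

lemma betaMinus_eq {μ : ℝ} (hμ : μ ≤ 1 / 4) : betaMinus μ * (betaMinus μ - 1) + μ = 0 := by
  have := Real.sq_sqrt (sub_nonneg.2 hμ)
  rw [betaMinus]; linear_combination this

/-- The shifted exponent lies above the larger root, where the characteristic polynomial is
positive. -/
lemma betaPlus_shift_pos {μ : ℝ} (hμ : μ ≤ 1 / 4) :
    0 < (betaPlus μ + 1 / 2) * (betaPlus μ + 1 / 2 - 1) + μ := by
  have h1 := betaPlus_eq hμ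
  have h2 : (betaPlus μ + 1 / 2) * (betaPlus μ + 1 / 2 - 1) + μ
      = Real.sqrt (1 / 4 - μ) + 1 / 4 := by
    have : betaPlus μ = 1 / 2 + Real.sqrt (1 / 4 - μ) := rfl
    linear_combination h1 + this
  rw [h2]; positivity

/-- Barriers of order `t ^ β₊`. -/
lemma exists_barriers_betaPlus {κ μ : ℝ} (hκ : 0 ≤ κ) (hμ : μ ≤ 1 / 4) :
    ∃ b₀ > 0, b₀ ≤ 1 ∧ ∀ b ≤ b₀,
      IsRadialSuper κ μ b (fun t => t ^ betaPlus μ + (-1) * t ^ (betaPlus μ + 1 / 2)) ∧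
      IsRadialSub κ μ b (fun t => t ^ betaPlus μ + 1 * t ^ (betaPlus μ + 1 / 2)) := by
  have hP := betaPlus_shift_pos hμ
  obtain ⟨b₀, hb₀, hb1, h⟩ := exists_rpow_lt (a := 1 / 2)
    (C := κ * (|betaPlus μ| + |betaPlus μ + 1 / 2|)) (abs_pos.2 hP.ne') (by norm_num)
  refine ⟨b₀, hb₀, hb1, fun b hb => ⟨?_, ?_⟩⟩
  · exact isRadialSuper_twoPow hκ (betaPlus_eq hμ) (by simp) le_rfl (hb.trans hb1) (by linarith)
      fun t ht => h t ⟨ht.1, ht.2.trans hb⟩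
  · exact isRadialSub_twoPow hκ (betaPlus_eq hμ) (by simp) le_rfl (hb.trans hb1) (by linarith)
      fun t ht => h t ⟨ht.1, ht.2.trans hb⟩

lemma twoPow_div_tendsto_zero {p q c : ℝ} (hcp : c < p) (hcq : c < q) :
    Tendsto (fun t : ℝ => (t ^ p + 1 * t ^ q) / t ^ c) (𝓝[>] 0) (𝓝 0) := by
  have h1 := (tendsto_rpow_zero (sub_pos.2 hcp)).add (tendsto_rpow_zero (sub_pos.2 hcq))
  rw [add_zero] at h1
  refine h1.congr' ?_
  filter_upwards [self_mem_nhdsWithin] with t ht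
  rw [Real.rpow_sub ht, Real.rpow_sub ht]
  ring

/-- Radial barriers in the subcritical case. -/
lemma hasRadialBarriers_of_lt {κ μ : ℝ} (hκ : 0 ≤ κ) (hμ : μ < 1 / 4) :
    ∃ b₀ > 0, HasRadialBarriers κ μ b₀ (fun t => t ^ betaPlus μ) (fun t => t ^ betaMinus μ) := by
  obtain ⟨b₁, hb₁, hb₁1, h₁⟩ := exists_barriers_betaPlus hκ hμ.le
  have hs : 0 < Real.sqrt (1 / 4 - μ) := Real.sqrt_pos.2 (sub_pos.2 hμ)
  have hlt : betaMinus μ < betaPlus μ := by rw [betaMinus, betaPlus]; linarith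
  -- The roots are 2√(1/4 - μ) apart, so β₋ + σ lies strictly between them and the polynomial is
  -- negative there; σ ≤ 1/2 is the margin needed by the power estimates.
  set σ := min (Real.sqrt (1 / 4 - μ)) (1 / 2) with hσ
  have hσ0 : 0 < σ := lt_min hs (by norm_num)
  have hσs : σ ≤ Real.sqrt (1 / 4 - μ) := min_le_left _ _
  have hσ2 : σ ≤ 1 / 2 := min_le_right _ _
  set p := betaMinus μ with hp
  have hP : (p + σ) * (p + σ - 1) + μ < 0 := by
    have h1 := betaMinus_eq hμ.le
    have h2 : p = 1 / 2 - Real.sqrt (1 / 4 - μ) := rfl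
    have h3 : (p + σ) * (p + σ - 1) + μ = σ * (σ - 2 * Real.sqrt (1 / 4 - μ)) := by
      rw [← hp] at h1
      linear_combination h1 + 2 * σ * h2
    rw [h3]
    exact mul_neg_of_pos_of_neg hσ0 (by linarith)
  obtain ⟨b₂, hb₂, hb₂1, h₂⟩ := exists_rpow_lt (a := 1 / 2)
    (C := κ * (|p| + |p + σ|)) (abs_pos.2 hP.ne) (by norm_num)
  refine ⟨min b₁ b₂, lt_min hb₁ hb₂, ?_⟩
  obtain ⟨hsup, hsub⟩ := h₁ (min b₁ b₂) (min_le_left _ _)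
  refine ⟨fun t ht => Real.rpow_pos_of_pos ht.1 _, fun t ht => Real.rpow_pos_of_pos ht.1 _,
    ⟨_, hsup, twoPow_div_tendsto_one (by linarith)⟩,
    ⟨fun t => t ^ p + 1 * t ^ (p + σ), ?_, twoPow_div_tendsto_one (by linarith)⟩,
    ⟨_, hsub, fun t ht => ?_, twoPow_div_tendsto_zero hlt (by linarith)⟩, fun b hb => ?_⟩
  · exact isRadialSuper_twoPow hκ (betaMinus_eq hμ.le) (by simp) (by linarith)
      ((min_le_left _ _).trans hb₁1) (by linarith)
      fun t ht => h₂ t ⟨ht.1, ht.2.trans (min_le_right _ _)⟩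
  · have := Real.rpow_pos_of_pos ht.1 (betaPlus μ + 1 / 2)
    linarith
  · have hb1 : b ≤ 1 := (hb.2.trans (min_le_left _ _)).trans hb₁1
    have hb2 : b ≤ b₂ := hb.2.trans (min_le_right _ _)
    have hbσ : 0 < b ^ (-σ) := Real.rpow_pos_of_pos hb.1 _
    have hbσ1 : 1 ≤ b ^ (-σ) := Real.one_le_rpow_of_pos_of_le_one_of_nonpos hb.1 hb1 (by linarith)
    -- The coefficient makes the function vanish at b and be positive on (0, b); since b ≤ 1 its
    -- modulus is at least 1.
    refine ⟨fun t => t ^ p + (-(b ^ (-σ))) * t ^ (p + σ), ?_, ?_, fun t ht => ?_, ?_⟩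
    · refine isRadialSub_twoPow hκ (betaMinus_eq hμ.le) ?_ (by linarith) hb1 ?_
        fun t ht => h₂ t ⟨ht.1, ht.2.trans hb2⟩
      · rwa [abs_neg, abs_of_pos hbσ]
      · exact mul_pos_of_neg_of_neg (neg_lt_zero.2 hbσ) hP
    · have : b ^ (-σ) * b ^ (p + σ) = b ^ p := by
        rw [← Real.rpow_add hb.1]; congr 1; ring
      simp only [neg_mul, this]
      linarith
    · have := mul_pos hbσ (Real.rpow_pos_of_pos ht.1 (p + σ))
      simp only [neg_mul]
      linarith
    · filter_upwards [Ioo_mem_nhdsGT hb.1] with t ht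
      have h3 : t ^ σ < b ^ σ := Real.rpow_lt_rpow ht.1.le ht.2 hσ0
      have h4 : b ^ (-σ) * b ^ σ = 1 := by rw [← Real.rpow_add hb.1]; simp
      have h5 := mul_lt_mul_of_pos_left h3 hbσ
      have h6 := mul_lt_mul_of_pos_left h5 (Real.rpow_pos_of_pos ht.1 p)
      rw [Real.rpow_add ht.1]
      rw [h4] at h6
      linarith

/-- Radial barriers in the critical case. -/
lemma hasRadialBarriers_critical {κ : ℝ} (hκ : 0 ≤ κ) :
    ∃ b₀ > 0, HasRadialBarriers κ (1 / 4) b₀ (fun t => t ^ (1 / 2 : ℝ))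
      (fun t => t ^ (1 / 2 : ℝ) * Real.log (1 / t)) := by
  obtain ⟨b₁, hb₁, hb₁1, h₁⟩ := exists_barriers_betaPlus (μ := 1 / 4) hκ le_rfl
  have hβ : betaPlus (1 / 4) = 1 / 2 := by simp [betaPlus]
  rw [hβ, show (1 / 2 + 1 / 2 : ℝ) = 1 by norm_num] at h₁
  obtain ⟨b₂, hb₂, hb₂1, h₂⟩ := exists_rpow_lt (a := 1 / 4) (C := 5 * κ) (c := 1 / 4)
    (by norm_num) (by norm_num)
  -- Staying below 1/2 keeps log(1/t) strictly positive.
  set b₀ := min (min b₁ b₂) (1 / 2) with hb₀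
  have hb₀1 : b₀ ≤ b₁ := (min_le_left _ _).trans (min_le_left _ _)
  have hb₀2 : b₀ ≤ b₂ := (min_le_left _ _).trans (min_le_right _ _)
  have hb₀h : b₀ ≤ 1 / 2 := min_le_right _ _
  have hlog : ∀ t : ℝ, Real.log (1 / t) = -Real.log t := fun t => by rw [one_div, Real.log_inv]
  have hlogtop : Tendsto (fun t => Real.log (1 / t)) (𝓝[>] 0) atTop := by
    simp_rw [hlog]
    exact tendsto_neg_atBot_atTop.comp Real.tendsto_log_nhdsGT_zero
  have hhalf : ∀ t : ℝ, 0 < t → t = t ^ (1 / 2 : ℝ) * t ^ (1 / 2 : ℝ) := fun t ht => by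
    rw [← Real.rpow_add ht]; norm_num
  refine ⟨b₀, by positivity, ?_⟩
  obtain ⟨hsup, hsub⟩ := h₁ b₀ hb₀1
  have hlogpos : ∀ t : ℝ, 0 < t → t < 1 → 0 < Real.log (1 / t) := fun t ht ht1 => by
    rw [hlog]; linarith [Real.log_neg ht ht1]
  refine ⟨fun t ht => Real.rpow_pos_of_pos ht.1 _, fun t ht => mul_pos
    (Real.rpow_pos_of_pos ht.1 _) (hlogpos t ht.1 (by linarith [ht.2])),
    ⟨_, hsup, twoPow_div_tendsto_one (by norm_num)⟩,
    ⟨_, isRadialSuper_sqrtLog hκ (hb₀1.trans hb₁1) fun t ht =>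
      h₂ t ⟨ht.1, ht.2.trans hb₀2⟩, ?_⟩, ⟨_, hsub, fun t ht => ?_, ?_⟩, fun b hb => ?_⟩
  · have h3 : Tendsto (fun t : ℝ => 1 - t ^ (1 / 2 : ℝ) * (Real.log (1 / t))⁻¹) (𝓝[>] 0)
        (𝓝 (1 - 0 * 0)) :=
      tendsto_const_nhds.sub ((tendsto_rpow_zero (by norm_num)).mul
        (tendsto_inv_atTop_zero.comp hlogtop))
    rw [mul_zero, sub_zero] at h3
    refine h3.congr' ?_
    filter_upwards [Ioo_mem_nhdsGT one_pos] with t ht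
    have h4 := hlogpos t ht.1 ht.2
    have h5 := Real.rpow_pos_of_pos ht.1 (1 / 2)
    have h6 : t ^ (1 / 2 : ℝ) * (0 - Real.log t) + -1 * t =
        t ^ (1 / 2 : ℝ) * Real.log (1 / t) - t ^ (1 / 2 : ℝ) * t ^ (1 / 2 : ℝ) := by
      rw [hlog, ← hhalf t ht.1]; ring
    rw [h6]
    field_simp
  · simp only [Real.rpow_one]
    linarith [ht.1]
  · have h3 : Tendsto (fun t : ℝ => (1 + t ^ (1 / 2 : ℝ)) * (Real.log (1 / t))⁻¹) (𝓝[>] 0)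
        (𝓝 ((1 + 0) * 0)) :=
      (tendsto_const_nhds.add (tendsto_rpow_zero (by norm_num))).mul
        (tendsto_inv_atTop_zero.comp hlogtop)
    rw [mul_zero] at h3
    refine h3.congr' ?_
    filter_upwards [Ioo_mem_nhdsGT one_pos] with t ht
    have h4 := hlogpos t ht.1 ht.2
    have h5 := Real.rpow_pos_of_pos ht.1 (1 / 2)
    have h6 : t ^ (1 / 2 : ℝ) + 1 * t ^ (1 : ℝ) =
        t ^ (1 / 2 : ℝ) * (1 + t ^ (1 / 2 : ℝ)) := by
      rw [mul_add, ← hhalf t ht.1, Real.rpow_one]; ring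
    rw [h6]
    field_simp
  · have hb1 : b < 1 := by linarith [hb.2]
    -- This B makes t^(1/2)(B - log t) + t vanish at t = b.
    set B := Real.log b - b ^ (1 / 2 : ℝ) with hB
    have hbs : 0 < b ^ (1 / 2 : ℝ) := Real.rpow_pos_of_pos hb.1 _
    have hbs1 : b ^ (1 / 2 : ℝ) ≤ 1 := Real.rpow_le_one hb.1.le hb1.le (by norm_num)
    refine ⟨_, isRadialSub_sqrtLog (B := B) hκ hb1.le (fun t ht => ?_) fun t ht =>
      h₂ t ⟨ht.1, ht.2.trans (hb.2.trans hb₀2)⟩, ?_, fun t ht => ?_, ?_⟩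
    · have h3 := Real.log_le_log ht.1 ht.2
      have h4 := Real.log_neg hb.1 hb1
      rw [abs_of_nonpos (h3.trans h4.le), abs_le]
      constructor <;> linarith
    · have : b ^ (1 / 2 : ℝ) * (B - Real.log b) + 1 * b = 0 := by
        have h3 := hhalf b hb.1
        rw [hB]; linear_combination h3
      exact this.le
    · have h3 : t ^ (1 / 2 : ℝ) ≤ b ^ (1 / 2 : ℝ) :=
        Real.rpow_le_rpow ht.1.le ht.2 (by norm_num)
      have h4 := Real.log_neg hb.1 hb1
      have h5 := Real.rpow_pos_of_pos ht.1 (1 / 2)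
      have h6 := hhalf t ht.1
      have h7 : t ^ (1 / 2 : ℝ) * (B - Real.log t) + 1 * t =
          t ^ (1 / 2 : ℝ) * (B - Real.log t + t ^ (1 / 2 : ℝ)) := by linear_combination h6
      rw [h7, hlog]
      exact mul_le_mul_of_nonneg_left (by linarith) h5.le
    · filter_upwards [Ioo_mem_nhdsGT one_pos, hlogtop.eventually_gt_atTop (-B)] with t ht htB
      have h5 := Real.rpow_pos_of_pos ht.1 (1 / 2)
      rw [hlog] at htB
      have := mul_pos h5 (show 0 < B - Real.log t by linarith)
      linarith [ht.1]

end RadialBarriers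

end

/-! ### The main theorem. -/

lemma HasCkBoundary.mono {N : ℕ} {k l : ℕ∞} {Ω : Set (EuclideanSpace ℝ (Fin N))}
    (h : HasCkBoundary l Ω) (hkl : k ≤ l) : HasCkBoundary k Ω := by
  intro x hx
  obtain ⟨U, f, hU, hxU, hf, h⟩ := h x hx
  exact ⟨U, f, hU, hxU, hf.of_le (WithTop.coe_le_coe.2 hkl), h⟩

theorem theorem2p11 {N : ℕ} (hN : 2 ≤ N) {k : ℕ∞} (hk : 2 ≤ k)
    {Ω : Set (EuclideanSpace ℝ (Fin N))} (hΩo : IsOpen Ω) (hΩc : IsConnected Ω)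
    (hΩb : Bornology.IsBounded Ω) (hΩk : HasCkBoundary k Ω) (μ : ℝ) :
    (μ < 1 / 4 →
      HasSharpSuperHarmonicBounds Ω μ
        (fun x => bdryDist Ω x ^ betaPlus μ) (fun x => bdryDist Ω x ^ betaMinus μ)) ∧
    (μ = 1 / 4 →
      HasSharpSuperHarmonicBounds Ω μ
        (fun x => bdryDist Ω x ^ (1 / 2 : ℝ))
        (fun x => bdryDist Ω x ^ (1 / 2 : ℝ) * Real.log (1 / bdryDist Ω x))) := by
  have : Nonempty (Fin N) := ⟨⟨0, by omega⟩⟩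
  -- With empty frontier, the nonempty Ω would be the whole space, which is unbounded.
  have hF : (frontier Ω).Nonempty := by
    refine nonempty_frontier_iff.2 ⟨hΩc.nonempty, fun h => ?_⟩
    exact NormedSpace.unbounded_univ ℝ (EuclideanSpace ℝ (Fin N)) (h ▸ hΩb)
  have hk2 : HasCkBoundary 2 Ω := hΩk.mono hk
  refine ⟨fun hμ => ?_, ?_⟩
  · exact hasSharpSuperHarmonicBounds_of_radialBarriers (lo := fun t => t ^ betaPlus μ)
      (up := fun t => t ^ betaMinus μ) hΩo hΩb hF hk2 fun κ hκ => hasRadialBarriers_of_lt hκ hμ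
  · rintro rfl
    exact hasSharpSuperHarmonicBounds_of_radialBarriers (lo := fun t => t ^ (1 / 2 : ℝ))
      (up := fun t => t ^ (1 / 2 : ℝ) * Real.log (1 / t)) hΩo hΩb hF hk2
      fun κ hκ => hasRadialBarriers_critical hκ
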